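/- Let $N\ge 1$, let $\Omega\subset\mathbb R^N$ be a bounded open set, and let $p:\Omega\to[2,\infty)$ be measurable and (essentially) bounded, with conjugate exponent $p'(x)=p(x)/(p(x)-1)$. Let $L^{p(x)}(\Omega)$ be the variable exponent Lebesgue space with the Luxemburg norm $\|w\|_{p(\cdot)}=\inf\{t>0:\int_\Omega(|w(x)|/t)^{p(x)}\,dx\le 1\}$, let $W^{1,p(x)}(\Omega)$ be the space of $u\in L^{p(x)}(\Omega)$ with weak gradient $\nabla u\in L^{p(x)}(\Omega)^N$, and let $W^{1,p(x)}_0(\Omega)$ be the closure of $C_c^\infty(\Omega)$ in it for the norm $\|u\|_{p(\cdot)}+\|\nabla u\|_{p(\cdot)}$; $H^1_0(\Omega)$ is the case $p\equiv2$. Let $f:\Omega\to\mathbb R$ be such that $fv$ is integrable on $\Omega$ for every $v\in W^{1,p(x)}_0(\Omega)$, let $r>0$, and define, for $(v,\nu,\eta)\in W^{1,p(x)}_0(\Omega)\times L^{p(x)}(\Omega)^N\times L^{p'(x)}(\Omega)^N$, the augmented Lagrangian $$\mathcal L_r(v,\nu,\eta)=\int_\Omega\frac{|\nu|^{p(x)}}{p(x)}\,dx-\int_\Omega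 fv\,dx+\int_\Omega\eta\cdot(\nabla v-\nu)\,dx+\frac r2\int_\Omega|\nabla v-\nu|^2\,dx .$$ Let $(u^*,\nu^*,\eta^*)$ be a saddle point of $\mathcal L_r$, i.e. $\mathcal L_r(u^*,\nu^*,\eta)\le\mathcal L_r(u^*,\nu^*,\eta^*)\le\mathcal L_r(u,\nu,\eta^*)$ for all $\eta\in L^{p'(x)}(\Omega)^N$, $u\in W^{1,p(x)}_0(\Omega)$ and $\nu\in L^{p(x)}(\Omega)^N$. Let $\nu_0\in L^{p(x)}(\Omega)^N$ and $\eta_1\in L^{p'(x)}(\Omega)^N$, and let $u_n\in W^{1,p(x)}_0(\Omega)$, $\nu_n\in L^{p(x)}(\Omega)^N$ and $\eta_{n+1}$ $(n\ge1)$ be a sequence of iterates of the decomposition–coordination algorithm, i.e. for every $n\ge1$: (a) $\displaystyle\int_\Omega f(u_n-v)\,dx+\int_\Omega(\eta_n+r(\nabla u_n-\nu_{n-1}))\cdot(\nabla v-\nabla u_n)\,dx\ge0$ for all $v\in W^{1,p(x)}_0(\Omega)$; (b) $\displaystyle\int_\Omega\big(|\nu_n|^{p(x)-2}\nu_n-\eta_n+r(\nu_n-\nabla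 u_n)\big)\cdot(\nu-\nu_n)\,dx\ge0$ for all $\nu\in L^{p(x)}(\Omega)^N$; (c) $\eta_{n+1}=\eta_n+r(\nabla u_n-\nu_n)$ a.e. in $\Omega$. Assume finally that $\eta_1-\eta^*\in L^2(\Omega)^N$ (for instance that $\eta_1$ and $\eta^*$ both lie in $L^2(\Omega)^N$). Then, as $n\to\infty$: 1. $u_n,u^*\in H^1_0(\Omega)$ and $u_n\to u^*$ strongly in $H^1_0(\Omega)$; 2. $\nu_n,\nu^*\in L^2(\Omega)^N$ and $\nu_n\to\nu^*$ strongly in $L^2(\Omega)^N$; 3. $\eta_{n+1}-\eta_n\in L^2(\Omega)^N$ and $\eta_{n+1}-\eta_n\to0$ strongly in $L^2(\Omega)^N$; 4. $(\eta_n-\eta^*)_{n\ge1}$ is bounded in $L^2(\Omega)^N$; hence, if $\eta_1\in L^2(\Omega)^N$, then $(\eta_n)_{n\ge1}$ is bounded in $L^2(\Omega)^N$. -/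

import Mathlib

open MeasureTheory Filter Topology
open scoped ENNReal NNReal

noncomputable section

namespace VarExp

/-- The Euclidean space `ℝ^N`. -/
abbrev Eu (N : ℕ) := EuclideanSpace ℝ (Fin N)

/-- The Luxemburg norm
`‖w‖_{p(·)} = inf {t > 0 : ∫_Ω (|w(x)| / t)^{p(x)} dx ≤ 1}` of `L^{p(x)}(Ω)`, with values
in `[0, ∞]`. It is `∞` if no finite `t` is admissible; the value `t = ∞` belongs to the set, so
that the infimum is never taken over the empty set. -/
def luxNorm {N : ℕ} {F : Type*} [NormedAddCommGroup F]
    (Ω : Set (Eu N)) (p : Eu N → ℝ) (w : Eu N → F) : ℝ≥0∞ :=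
  sInf {t : ℝ≥0∞ | 0 < t ∧ ∫⁻ x in Ω, (‖w x‖ₑ / t) ^ (p x) ≤ 1}

/-- `w ∈ L^{p(x)}(Ω)`: measurable with finite Luxemburg norm. Scalar functions are `F = ℝ`, vector
fields are `F = ℝ^N`. -/
def MemVarLp {N : ℕ} {F : Type*} [NormedAddCommGroup F]
    (Ω : Set (Eu N)) (p : Eu N → ℝ) (w : Eu N → F) : Prop :=
  AEStronglyMeasurable w (volume.restrict Ω) ∧ luxNorm Ω p w < ⊤

/-- The conjugate exponent `p'(x) = p(x) / (p(x) - 1)`. -/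
def conjExp {N : ℕ} (p : Eu N → ℝ) : Eu N → ℝ := fun x => p x / (p x - 1)

/-- `φ ∈ C_c^∞(Ω)`. -/
def IsTestFun {N : ℕ} (Ω : Set (Eu N)) (φ : Eu N → ℝ) : Prop :=
  ContDiff ℝ (⊤ : ℕ∞) φ ∧ HasCompactSupport φ ∧ tsupport φ ⊆ Ω

/-- `g` is a weak (distributional) gradient of `u` on `Ω`:
`∫_Ω u ∇φ = - ∫_Ω φ g` for all `φ ∈ C_c^∞(Ω)`. -/
def HasWeakGrad {N : ℕ} (Ω : Set (Eu N)) (u : Eu N → ℝ) (g : Eu N → Eu N) : Prop :=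
  LocallyIntegrableOn u Ω ∧ LocallyIntegrableOn g Ω ∧
    ∀ φ : Eu N → ℝ, IsTestFun Ω φ →
      ∫ x in Ω, u x • gradient φ x = - ∫ x in Ω, φ x • g x

open Classical in
/-- The weak gradient `∇u` on `Ω` (unique up to null sets; only used for functions that have
one). -/
def weakGrad {N : ℕ} (Ω : Set (Eu N)) (u : Eu N → ℝ) : Eu N → Eu N :=
  if h : ∃ g, HasWeakGrad Ω u g then h.choose else 0

/-- `u ∈ W^{1,p(x)}(Ω)`. -/
def MemW1 {N : ℕ} (Ω : Set (Eu N)) (p : Eu N → ℝ) (u : Eu N → ℝ) : Prop :=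
  (∃ g, HasWeakGrad Ω u g) ∧ MemVarLp Ω p u ∧ MemVarLp Ω p (weakGrad Ω u)

/-- `u ∈ W_0^{1,p(x)}(Ω)`, the closure of `C_c^∞(Ω)` in `W^{1,p(x)}(Ω)`. -/
def MemW10 {N : ℕ} (Ω : Set (Eu N)) (p : Eu N → ℝ) (u : Eu N → ℝ) : Prop :=
  MemW1 Ω p u ∧ ∃ φ : ℕ → Eu N → ℝ, (∀ k, IsTestFun Ω (φ k)) ∧
    Tendsto (fun k => luxNorm Ω p (u - φ k) + luxNorm Ω p (weakGrad Ω u - gradient (φ k)))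
      atTop (𝓝 0)

/-- `u ∈ H_0^1(Ω) = W_0^{1,2}(Ω)`. -/
def MemH10 {N : ℕ} (Ω : Set (Eu N)) (u : Eu N → ℝ) : Prop := MemW10 Ω (fun _ => 2) u

/-- The norm `(‖w‖_{L²}² + ‖∇w‖_{L²}²)^{1/2}` of `H^1(Ω)`. -/
def h1Norm {N : ℕ} (Ω : Set (Eu N)) (w : Eu N → ℝ) : ℝ≥0∞ :=
  (eLpNorm w 2 (volume.restrict Ω) ^ 2 +
    eLpNorm (weakGrad Ω w) 2 (volume.restrict Ω) ^ 2) ^ (1 / 2 : ℝ)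

/-- `F(ν) = ∫_Ω |ν|^{p(x)} / p(x) dx`. -/
def energyF {N : ℕ} (Ω : Set (Eu N)) (p : Eu N → ℝ) (ν : Eu N → Eu N) : ℝ :=
  ∫ x in Ω, ‖ν x‖ ^ (p x) / p x

/-- `G(v) = - ∫_Ω f v dx`. -/
def energyG {N : ℕ} (Ω : Set (Eu N)) (f : Eu N → ℝ) (v : Eu N → ℝ) : ℝ :=
  - ∫ x in Ω, f x * v x

/-- The augmented Lagrangian
`L_r(v,ν,η) = F(ν) + G(v) + ∫_Ω η·(∇v - ν) dx + (r/2) ∫_Ω |∇v - ν|² dx`. -/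
def augLagrangian {N : ℕ} (Ω : Set (Eu N)) (p : Eu N → ℝ) (f : Eu N → ℝ) (r : ℝ)
    (v : Eu N → ℝ) (ν η : Eu N → Eu N) : ℝ :=
  energyF Ω p ν + energyG Ω f v
    + ∫ x in Ω, inner ℝ (η x) (weakGrad Ω v x - ν x)
    + r / 2 * ∫ x in Ω, ‖weakGrad Ω v x - ν x‖ ^ 2

/-- `(us, νs, ηs)` is a saddle point of `L_r` on
`W_0^{1,p(x)}(Ω) × L^{p(x)}(Ω)^N × L^{p'(x)}(Ω)^N`. -/
structure IsSaddlePoint {N : ℕ} (Ω : Set (Eu N)) (p : Eu N → ℝ) (f : Eu N → ℝ) (r : ℝ)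
    (us : Eu N → ℝ) (νs ηs : Eu N → Eu N) : Prop where
  mem_u : MemW10 Ω p us
  mem_ν : MemVarLp Ω p νs
  mem_η : MemVarLp Ω (conjExp p) ηs
  le_left : ∀ η : Eu N → Eu N, MemVarLp Ω (conjExp p) η →
    augLagrangian Ω p f r us νs η ≤ augLagrangian Ω p f r us νs ηs
  le_right : ∀ (u : Eu N → ℝ) (ν : Eu N → Eu N), MemW10 Ω p u → MemVarLp Ω p ν →
    augLagrangian Ω p f r us νs ηs ≤ augLagrangian Ω p f r u ν ηs

/-- The decomposition-coordination iteration started at `(ν 0, η 1)`: for every `n ≥ 1`, step (a)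
determines `u n` from `(ν (n - 1), η n)`, step (b) determines `ν n`, and step (c) determines
`η (n + 1)`. The entries `u 0` and `η 0` play no role. -/
structure IsIteration {N : ℕ} (Ω : Set (Eu N)) (p : Eu N → ℝ) (f : Eu N → ℝ) (r : ℝ)
    (u : ℕ → Eu N → ℝ) (ν η : ℕ → Eu N → Eu N) : Prop where
  init_ν : MemVarLp Ω p (ν 0)
  init_η : MemVarLp Ω (conjExp p) (η 1)
  mem_u : ∀ n, 1 ≤ n → MemW10 Ω p (u n)
  mem_ν : ∀ n, 1 ≤ n → MemVarLp Ω p (ν n)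
  step_a : ∀ n, 1 ≤ n → ∀ v : Eu N → ℝ, MemW10 Ω p v →
    0 ≤ (∫ x in Ω, f x * (u n x - v x))
      + ∫ x in Ω, inner ℝ (η n x + r • (weakGrad Ω (u n) x - ν (n - 1) x))
          (weakGrad Ω v x - weakGrad Ω (u n) x)
  step_b : ∀ n, 1 ≤ n → ∀ μ : Eu N → Eu N, MemVarLp Ω p μ →
    0 ≤ ∫ x in Ω, inner ℝ
      (‖ν n x‖ ^ (p x - 2) • ν n x - η n x + r • (ν n x - weakGrad Ω (u n) x))
      (μ x - ν n x)
  step_c : ∀ n, 1 ≤ n → ∀ᵐ x ∂(volume.restrict Ω),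
    η (n + 1) x = η n x + r • (weakGrad Ω (u n) x - ν n x)

end VarExp

end

/-! Write `E n`, `U n`, `V n` for the errors `η n - ηs`, `∇(u n) - ∇us`, `ν n - νs`. Since `p ≥ 2`
and `Ω` is bounded, `L^p ⊆ L² ⊆ L^{p'}`, so by (c) all three stay in `L²` once `E 1` does, although
the multipliers themselves need not. The convergence argument takes place in this Hilbert space.

The saddle point gives `∇us = νs`, the weak equation for `ηs`, and the subgradient property of `ηs`
at `νs` (`weakGrad_ae_eq`, `variational_left`, `variational_right`). Comparing these with (a), (b),
(c) gives `ErrorRelations`. Uniform convexity of `|ξ|^q / q` for `q ≥ 2`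
(`norm_rpow_div_uniformConvex`) adds a gain `M n`, a modular of `V n / 2`, to the relation from (b).

The energy `‖E (n + 1)‖² + r²‖V n‖²` then drops at each step by at least `r²‖U (n + 1) - V (n + 1)‖²
+ r²‖V (n + 1) - V n‖²` (`energy_decay`). Hence `E` and `V` are bounded and both differences tend to
zero, which forces `M n → 0`. As `p` is bounded, small modular means small `L²` norm
(`tendsto_toL2_of_modular`), so `V → 0` and `U = (U - V) + V → 0`. Poincaré's inequality passes from
gradients to functions, and the multiplier increments are `r (U - V)`. -/

namespace VarExp

variable {N : ℕ} {F : Type*} [NormedAddCommGroup F] {Ω : Set (Eu N)} {p : Eu N → ℝ}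

/-! ### Luxemburg norms -/

theorem luxNorm_le_of_modular_le {w : Eu N → F} {t : ℝ≥0∞} (ht : 0 < t)
    (h : ∫⁻ x in Ω, (‖w x‖ₑ / t) ^ (p x) ≤ 1) : luxNorm Ω p w ≤ t :=
  sInf_le ⟨ht, h⟩

theorem luxNorm_le_mul_luxNorm {G : Type*} [NormedAddCommGroup G] {q : Eu N → ℝ}
    {w : Eu N → F} {w' : Eu N → G} {K : ℝ≥0∞} (hK0 : K ≠ 0) (hK : K ≠ ⊤)
    (h : ∀ t : ℝ≥0∞, 0 < t → ∫⁻ x in Ω, (‖w x‖ₑ / t) ^ (p x) ≤ 1 →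
      ∫⁻ x in Ω, (‖w' x‖ₑ / (K * t)) ^ (q x) ≤ 1) :
    luxNorm Ω q w' ≤ K * luxNorm Ω p w := by
  have h2 : luxNorm Ω q w' / K ≤ luxNorm Ω p w := by
    refine le_sInf fun t ⟨ht, h1⟩ => ?_
    rw [ENNReal.div_le_iff hK0 hK, mul_comm]
    exact luxNorm_le_of_modular_le (ENNReal.mul_pos hK0 ht.ne') (h t ht h1)
  rwa [ENNReal.div_le_iff hK0 hK, mul_comm] at h2

/-- The factor `‖c‖ₑ + 1` in place of `‖c‖ₑ` never vanishes, so `c = 0` is not a special case; only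
finiteness and limits are at stake. -/
theorem luxNorm_smul_le [NormedSpace ℝ F] (hp : ∀ᵐ x ∂(volume.restrict Ω), 0 ≤ p x)
    (c : ℝ) (w : Eu N → F) :
    luxNorm Ω p (c • w) ≤ (‖c‖ₑ + 1) * luxNorm Ω p w := by
  refine luxNorm_le_mul_luxNorm (by simp) (by simp) fun t ht h => le_trans ?_ h
  refine lintegral_mono_ae ?_
  filter_upwards [hp] with x hx
  refine ENNReal.rpow_le_rpow ?_ hx
  rw [Pi.smul_apply, enorm_smul]
  calc ‖c‖ₑ * ‖w x‖ₑ / ((‖c‖ₑ + 1) * t) ≤ (‖c‖ₑ + 1) * ‖w x‖ₑ / ((‖c‖ₑ + 1) * t) := by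
        gcongr; exact le_self_add
    _ = ‖w x‖ₑ / t := ENNReal.mul_div_mul_left _ _ (by simp) (by simp)

theorem half_add_rpow_le {q : ℝ} (hq : 1 ≤ q) (a b : ℝ≥0∞) :
    ((a + b) / 2) ^ q ≤ (a ^ q + b ^ q) / 2 := by
  have h := ENNReal.rpow_arith_mean_le_arith_mean2_rpow (1 / 2) (1 / 2) a b
    (by simpa using ENNReal.inv_two_add_inv_two) hq
  rw [← mul_add, ← mul_add] at h
  simpa [ENNReal.div_eq_inv_mul] using h

theorem aemeasurable_modular (hpm : AEMeasurable p (volume.restrict Ω)) {w : Eu N → F}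
    (hw : AEStronglyMeasurable w (volume.restrict Ω)) (t : ℝ≥0∞) :
    AEMeasurable (fun x => (‖w x‖ₑ / t) ^ (p x)) (volume.restrict Ω) :=
  (hw.enorm.div_const t).pow hpm

/-- If `s` and `t` are admissible for `w` and `z`, midpoint convexity makes `2 (s + t)` admissible
for the sum. The superfluous factor 2 does no harm to membership or convergence to zero. -/
theorem luxNorm_add_le (hpm : AEMeasurable p (volume.restrict Ω))
    (hp : ∀ᵐ x ∂(volume.restrict Ω), 1 ≤ p x) {w z : Eu N → F}
    (hw : AEStronglyMeasurable w (volume.restrict Ω)) :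
    luxNorm Ω p (w + z) ≤ 2 * (luxNorm Ω p w + luxNorm Ω p z) := by
  rw [mul_comm, ← ENNReal.div_le_iff (by simp) (by simp)]
  have key : ∀ s ∈ {t : ℝ≥0∞ | 0 < t ∧ ∫⁻ x in Ω, (‖w x‖ₑ / t) ^ (p x) ≤ 1},
      ∀ t ∈ {t : ℝ≥0∞ | 0 < t ∧ ∫⁻ x in Ω, (‖z x‖ₑ / t) ^ (p x) ≤ 1},
      luxNorm Ω p (w + z) / 2 ≤ s + t := by
    rintro s ⟨hs, hs1⟩ t ⟨ht, ht1⟩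
    rw [ENNReal.div_le_iff (by simp) (by simp)]
    refine luxNorm_le_of_modular_le (by positivity) ?_
    calc ∫⁻ x in Ω, (‖(w + z) x‖ₑ / ((s + t) * 2)) ^ (p x)
        ≤ ∫⁻ x in Ω, ((‖w x‖ₑ / s) ^ (p x) + (‖z x‖ₑ / t) ^ (p x)) / 2 := by
          refine lintegral_mono_ae ?_
          filter_upwards [hp] with x hx
          refine le_trans (ENNReal.rpow_le_rpow ?_ (by linarith)) (half_add_rpow_le hx _ _)
          calc ‖(w + z) x‖ₑ / ((s + t) * 2) ≤ (‖w x‖ₑ + ‖z x‖ₑ) / ((s + t) * 2) := by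
                gcongr; exact enorm_add_le _ _
            _ = (‖w x‖ₑ / (s + t) + ‖z x‖ₑ / (s + t)) / 2 := by
                simp only [ENNReal.div_eq_inv_mul]
                rw [ENNReal.mul_inv (by simp) (by simp)]
                ring
            _ ≤ (‖w x‖ₑ / s + ‖z x‖ₑ / t) / 2 := by
                gcongr
                · exact le_self_add
                · exact le_add_self
      _ = ((∫⁻ x in Ω, (‖w x‖ₑ / s) ^ (p x)) + ∫⁻ x in Ω, (‖z x‖ₑ / t) ^ (p x)) / 2 := by
          simp only [div_eq_mul_inv _ (2 : ℝ≥0∞)]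
          rw [lintegral_mul_const' _ _ (by simp),
            lintegral_add_left' (aemeasurable_modular hpm hw s)]
      _ ≤ (1 + 1) / 2 := by gcongr
      _ = 1 := by rw [one_add_one_eq_two]; exact ENNReal.div_self (by simp) (by simp)
  have key' : ∀ s ∈ {t : ℝ≥0∞ | 0 < t ∧ ∫⁻ x in Ω, (‖w x‖ₑ / t) ^ (p x) ≤ 1},
      luxNorm Ω p (w + z) / 2 ≤ s + luxNorm Ω p z := fun s hs => by
    rw [luxNorm.eq_def Ω p z, sInf_eq_iInf', ENNReal.add_iInf]
    exact le_iInf fun t => key s hs t t.2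
  rw [luxNorm.eq_def Ω p w, sInf_eq_iInf', ENNReal.iInf_add]
  exact le_iInf fun s => key' s s.2

theorem luxNorm_congr_ae {w z : Eu N → F} (h : w =ᵐ[volume.restrict Ω] z) :
    luxNorm Ω p w = luxNorm Ω p z := by
  unfold luxNorm
  congr 1
  ext t
  have : ∫⁻ x in Ω, (‖w x‖ₑ / t) ^ (p x) = ∫⁻ x in Ω, (‖z x‖ₑ / t) ^ (p x) :=
    lintegral_congr_ae (h.mono fun x hx => by simp only [hx])
  simp only [Set.mem_ofPred_eq, this]

theorem MemVarLp.congr_ae {w z : Eu N → F} (hw : MemVarLp Ω p w)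
    (h : w =ᵐ[volume.restrict Ω] z) : MemVarLp Ω p z :=
  ⟨hw.1.congr h, luxNorm_congr_ae (p := p) h ▸ hw.2⟩

theorem MemVarLp.add (hpm : AEMeasurable p (volume.restrict Ω))
    (hp : ∀ᵐ x ∂(volume.restrict Ω), 1 ≤ p x) {w z : Eu N → F}
    (hw : MemVarLp Ω p w) (hz : MemVarLp Ω p z) : MemVarLp Ω p (w + z) :=
  ⟨hw.1.add hz.1, (luxNorm_add_le hpm hp hw.1).trans_lt
    (ENNReal.mul_lt_top (by simp) (ENNReal.add_lt_top.2 ⟨hw.2, hz.2⟩))⟩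

theorem MemVarLp.smul [NormedSpace ℝ F] (hp : ∀ᵐ x ∂(volume.restrict Ω), 0 ≤ p x)
    {w : Eu N → F} (hw : MemVarLp Ω p w) (c : ℝ) : MemVarLp Ω p (c • w) :=
  ⟨hw.1.const_smul c, (luxNorm_smul_le hp c w).trans_lt (ENNReal.mul_lt_top (by simp) hw.2)⟩

theorem rpow_le_one_add_rpow {q q' : ℝ} (hq : 0 ≤ q) (h : q ≤ q') (a : ℝ≥0∞) :
    a ^ q ≤ 1 + a ^ q' := by
  rcases le_total a 1 with ha | ha
  · exact (ENNReal.rpow_le_one ha hq).trans le_self_add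
  · exact (ENNReal.rpow_le_rpow_of_exponent_le ha h).trans le_add_self

/-- Comparison of Luxemburg norms for ordered exponents on a set of finite measure. -/
theorem exists_luxNorm_le_mul (hΩ : volume Ω ≠ ⊤) {q : Eu N → ℝ}
    (hq : ∀ᵐ x ∂(volume.restrict Ω), 1 ≤ q x) (hqp : ∀ᵐ x ∂(volume.restrict Ω), q x ≤ p x) :
    ∃ K : ℝ≥0∞, K ≠ ⊤ ∧ ∀ w : Eu N → F, luxNorm Ω q w ≤ K * luxNorm Ω p w := by
  have hK : volume Ω + 1 ≠ ⊤ := by simpa using hΩ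
  -- With `K = |Ω| + 1 ≥ 1` and `q ≥ 1` one has `K^{-q} ≤ K⁻¹`, while `a^q ≤ 1 + a^p` integrates to
  -- at most `|Ω| + 1 = K`.
  refine ⟨volume Ω + 1, hK, fun w => ?_⟩
  refine luxNorm_le_mul_luxNorm (by simp) hK fun t ht h => ?_
  calc ∫⁻ x in Ω, (‖w x‖ₑ / ((volume Ω + 1) * t)) ^ (q x)
      ≤ ∫⁻ x in Ω, (volume Ω + 1)⁻¹ * (1 + (‖w x‖ₑ / t) ^ (p x)) := by
        refine lintegral_mono_ae ?_
        filter_upwards [hq, hqp] with x h1 h2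
        have e : ‖w x‖ₑ / ((volume Ω + 1) * t) = (volume Ω + 1)⁻¹ * (‖w x‖ₑ / t) := by
          simp only [ENNReal.div_eq_inv_mul]
          rw [ENNReal.mul_inv (by simp) (Or.inl hK)]
          ring
        rw [e, ENNReal.mul_rpow_of_nonneg _ _ (by linarith)]
        gcongr
        · refine ENNReal.rpow_le_self_of_le_one ?_ h1
          exact ENNReal.inv_le_one.2 le_add_self
        · exact rpow_le_one_add_rpow (by linarith) h2 _
    _ = (volume Ω + 1)⁻¹ * (volume Ω + ∫⁻ x in Ω, (‖w x‖ₑ / t) ^ (p x)) := by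
        rw [lintegral_const_mul' _ _ (by simp), lintegral_add_left measurable_const]
        simp
    _ ≤ (volume Ω + 1)⁻¹ * (volume Ω + 1) := by gcongr
    _ = 1 := ENNReal.inv_mul_cancel (by simp) hK

theorem MemVarLp.mono_exponent (hΩ : volume Ω ≠ ⊤) {q : Eu N → ℝ}
    (hq : ∀ᵐ x ∂(volume.restrict Ω), 1 ≤ q x) (hqp : ∀ᵐ x ∂(volume.restrict Ω), q x ≤ p x)
    {w : Eu N → F} (hw : MemVarLp Ω p w) : MemVarLp Ω q w := by
  obtain ⟨K, hK, h⟩ := exists_luxNorm_le_mul (F := F) hΩ hq hqp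
  exact ⟨hw.1, (h w).trans_lt (ENNReal.mul_lt_top hK.lt_top hw.2)⟩

/-- For the constant exponent 2 the factor `t⁻²` leaves the modular, so every admissible `t`
dominates the `L²` norm. -/
theorem eLpNorm_two_le_luxNorm (w : Eu N → F) :
    eLpNorm w 2 (volume.restrict Ω) ≤ luxNorm Ω (fun _ => 2) w := by
  refine le_sInf fun t ⟨ht, h⟩ => ?_
  rcases eq_or_ne t ⊤ with rfl | htt
  · exact le_top
  rw [eLpNorm_eq_lintegral_rpow_enorm_toReal (by simp) (by simp)]
  simp only [ENNReal.toReal_ofNat]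
  rw [one_div, ENNReal.rpow_inv_le_iff (by norm_num)]
  have e : ∀ x, (‖w x‖ₑ / t) ^ (2 : ℝ) = (t ^ (2 : ℝ))⁻¹ * ‖w x‖ₑ ^ (2 : ℝ) := fun x => by
    rw [ENNReal.div_rpow_of_nonneg _ _ (by norm_num), ENNReal.div_eq_inv_mul]
  have h0 : t ^ (2 : ℝ) ≠ 0 := by simp [ht.ne']
  have h1 : t ^ (2 : ℝ) ≠ ⊤ := by simp [htt]
  simp only [e] at h
  rw [lintegral_const_mul' _ _ (by simp [ht.ne']), ← ENNReal.div_eq_inv_mul,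
    ENNReal.div_le_iff h0 h1, one_mul] at h
  exact h

theorem MemVarLp.memLp_two (hΩ : volume Ω ≠ ⊤) (hp2 : ∀ᵐ x ∂(volume.restrict Ω), 2 ≤ p x)
    {w : Eu N → F} (hw : MemVarLp Ω p w) : MemLp w 2 (volume.restrict Ω) :=
  ⟨hw.1, (eLpNorm_two_le_luxNorm w).trans_lt
    (MemVarLp.mono_exponent (q := fun _ => 2) hΩ (by simp) hp2 hw).2⟩

/-- For bounded exponents the modular of an element of `L^{p(x)}` is finite. -/
theorem MemVarLp.integrable_rpow (hpm : AEMeasurable p (volume.restrict Ω))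
    (hp0 : ∀ᵐ x ∂(volume.restrict Ω), 0 ≤ p x)
    (hpb : ∃ P : ℝ, ∀ᵐ x ∂(volume.restrict Ω), p x ≤ P) {w : Eu N → F}
    (hw : MemVarLp Ω p w) : Integrable (fun x => ‖w x‖ ^ (p x)) (volume.restrict Ω) := by
  obtain ⟨P, hP⟩ := hpb
  obtain ⟨t, ⟨ht, h1⟩, htt⟩ := sInf_lt_iff.1 hw.2
  refine ⟨(hw.1.norm.aemeasurable.pow hpm).aestronglyMeasurable, ?_⟩
  -- A base of at least 1 lets the exponent `p x` be raised to its bound `P`, so that `t ^ p x` is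
  -- bounded by a constant.
  have hT : max t 1 ≠ ⊤ := by simp [htt.ne]
  calc ∫⁻ x in Ω, ‖‖w x‖ ^ (p x)‖ₑ
      ≤ ∫⁻ x in Ω, (max t 1) ^ P * (‖w x‖ₑ / t) ^ (p x) := by
        refine lintegral_mono_ae ?_
        filter_upwards [hP, hp0] with x h2 h0
        rw [Real.enorm_rpow_of_nonneg (norm_nonneg _) h0, enorm_norm]
        calc ‖w x‖ₑ ^ p x = (t * (‖w x‖ₑ / t)) ^ p x := by
              rw [ENNReal.mul_div_cancel ht.ne' htt.ne]
          _ = t ^ p x * (‖w x‖ₑ / t) ^ p x := ENNReal.mul_rpow_of_nonneg _ _ h0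
          _ ≤ (max t 1) ^ P * (‖w x‖ₑ / t) ^ p x := by
              gcongr
              exact (ENNReal.rpow_le_rpow (le_max_left _ _) h0).trans
                (ENNReal.rpow_le_rpow_of_exponent_le (le_max_right _ _) h2)
    _ = (max t 1) ^ P * ∫⁻ x in Ω, (‖w x‖ₑ / t) ^ (p x) := by
        rw [lintegral_const_mul'' _ (aemeasurable_modular hpm hw.1 t)]
    _ < ⊤ := by
        refine ENNReal.mul_lt_top (lt_top_iff_ne_top.2 ?_) (h1.trans_lt (by simp))
        exact ENNReal.rpow_ne_top_of_ne_zero (lt_of_lt_of_le one_pos (le_max_right _ _)).ne' hT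

/-! ### Conjugate exponents and the duality pairing -/

section ConjExp

theorem aemeasurable_conjExp (hpm : AEMeasurable p (volume.restrict Ω)) :
    AEMeasurable (conjExp p) (volume.restrict Ω) :=
  hpm.div (hpm.sub_const 1)

theorem holderConjugate_conjExp {x : Eu N} (h : 2 ≤ p x) :
    (p x).HolderConjugate (conjExp p x) :=
  Real.HolderConjugate.conjExponent (by linarith)

theorem conjExp_le_two {x : Eu N} (h : 2 ≤ p x) : conjExp p x ≤ 2 := by
  unfold conjExp
  rw [div_le_iff₀ (by linarith)]
  linarith

/-- The duality pairing of `L^{p'(x)}` and `L^{p(x)}` is well defined. -/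
theorem integrable_inner_of_memVarLp (hpm : AEMeasurable p (volume.restrict Ω))
    (hp2 : ∀ᵐ x ∂(volume.restrict Ω), 2 ≤ p x)
    (hpb : ∃ P : ℝ, ∀ᵐ x ∂(volume.restrict Ω), p x ≤ P) {a b : Eu N → Eu N}
    (ha : MemVarLp Ω (conjExp p) a) (hb : MemVarLp Ω p b) :
    Integrable (fun x => inner ℝ (a x) (b x)) (volume.restrict Ω) := by
  have h1 := ha.integrable_rpow (aemeasurable_conjExp hpm)
    (hp2.mono fun x hx => (holderConjugate_conjExp hx).symm.nonneg)
    ⟨2, hp2.mono fun x hx => conjExp_le_two hx⟩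
  have h2 := hb.integrable_rpow hpm (hp2.mono fun x hx => by linarith) hpb
  refine (h1.add h2).mono' (ha.1.inner hb.1) ?_
  filter_upwards [hp2] with x hx
  have hc := (holderConjugate_conjExp hx).symm
  refine (norm_inner_le_norm _ _).trans ?_
  refine (Real.young_inequality_of_nonneg (norm_nonneg _) (norm_nonneg _) hc).trans ?_
  exact add_le_add (div_le_self (by positivity) hc.lt.le)
    (div_le_self (by positivity) hc.symm.lt.le)

end ConjExp

end VarExp

namespace VarExp

variable {N : ℕ} {Ω : Set (Eu N)} {p : Eu N → ℝ}

/-! ### Test functions and weak gradients -/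

theorem gradient_add_smul {φ ψ : Eu N → ℝ} (hφ : Differentiable ℝ φ) (hψ : Differentiable ℝ ψ)
    (c : ℝ) : gradient (φ + c • ψ) = gradient φ + c • gradient ψ := by
  ext1 x
  simp only [gradient, Pi.add_apply, Pi.smul_apply]
  rw [fderiv_add (hφ x) ((hψ x).const_smul c), fderiv_const_smul (hψ x)]
  simp

theorem IsTestFun.add_smul {φ ψ : Eu N → ℝ} (hφ : IsTestFun Ω φ) (hψ : IsTestFun Ω ψ) (c : ℝ) :
    IsTestFun Ω (φ + c • ψ) := by
  refine ⟨hφ.1.add (contDiff_const.smul hψ.1), hφ.2.1.add (hψ.2.1.smul_left (f := fun _ => c)), ?_⟩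
  refine (tsupport_add _ _).trans (Set.union_subset hφ.2.2 ?_)
  exact (closure_mono (Function.support_const_smul_subset c ψ)).trans hψ.2.2

theorem IsTestFun.differentiable {φ : Eu N → ℝ} (hφ : IsTestFun Ω φ) : Differentiable ℝ φ :=
  hφ.1.differentiable (by simp)

theorem IsTestFun.continuous_gradient {φ : Eu N → ℝ} (hφ : IsTestFun Ω φ) :
    Continuous (gradient φ) :=
  (InnerProductSpace.toDual ℝ (Eu N)).symm.continuous.comp (hφ.1.continuous_fderiv (by simp))

theorem support_gradient_subset (φ : Eu N → ℝ) :
    Function.support (gradient φ) ⊆ tsupport φ := by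
  intro x hx
  refine support_fderiv_subset ℝ (f := φ) fun h => hx ?_
  simp [gradient, h]

theorem IsTestFun.integrableOn_smul {F : Type*} [NormedAddCommGroup F] [NormedSpace ℝ F]
    {φ : Eu N → ℝ} (hφ : IsTestFun Ω φ) {g : Eu N → F} (hg : LocallyIntegrableOn g Ω) :
    IntegrableOn (fun x => φ x • g x) Ω := by
  have h1 : IntegrableOn g (tsupport φ) := hg.integrableOn_compact_subset hφ.2.2 hφ.2.1
  have h2 := h1.continuousOn_smul hφ.1.continuous.continuousOn hφ.2.1
  refine ((integrableOn_iff_integrable_of_support_subset ?_).1 h2).integrableOn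
  intro x hx
  exact subset_tsupport φ fun h => hx (by simp [h])

theorem IsTestFun.integrableOn_smul_gradient {φ : Eu N → ℝ} (hφ : IsTestFun Ω φ)
    {u : Eu N → ℝ} (hu : LocallyIntegrableOn u Ω) :
    IntegrableOn (fun x => u x • gradient φ x) Ω := by
  have h1 : IntegrableOn u (tsupport φ) := hu.integrableOn_compact_subset hφ.2.2 hφ.2.1
  have h2 := h1.smul_continuousOn hφ.continuous_gradient.continuousOn hφ.2.1
  refine ((integrableOn_iff_integrable_of_support_subset ?_).1 h2).integrableOn
  intro x hx
  exact support_gradient_subset φ fun h => hx (by simp [h])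

theorem HasWeakGrad.add_smul {u v : Eu N → ℝ} {g h : Eu N → Eu N} (hu : HasWeakGrad Ω u g)
    (hv : HasWeakGrad Ω v h) (c : ℝ) : HasWeakGrad Ω (u + c • v) (g + c • h) := by
  refine ⟨hu.1.add (hv.1.smul c), hu.2.1.add (hv.2.1.smul c), fun φ hφ => ?_⟩
  have e1 : ∀ x, (u + c • v) x • gradient φ x = u x • gradient φ x + c • (v x • gradient φ x) :=
    fun x => by simp [_root_.add_smul, mul_smul]
  have e2 : ∀ x, φ x • (g + c • h) x = φ x • g x + c • (φ x • h x) :=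
    fun x => by simp [smul_add, smul_comm c (φ x)]
  simp only [e1, e2]
  have i1 : IntegrableOn (fun x => c • (v x • gradient φ x)) Ω :=
    (hφ.integrableOn_smul_gradient hv.1).smul c
  have i2 : IntegrableOn (fun x => c • (φ x • h x)) Ω := (hφ.integrableOn_smul hv.2.1).smul c
  rw [integral_add (hφ.integrableOn_smul_gradient hu.1) i1,
    integral_add (hφ.integrableOn_smul hu.2.1) i2,
    integral_smul, integral_smul, hu.2.2 φ hφ, hv.2.2 φ hφ]
  simp [add_comm]

/-- The fundamental lemma of the calculus of variations, applied to the difference of the two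
gradients. It makes the choice in `weakGrad` harmless and `weakGrad` linear up to null sets. -/
theorem HasWeakGrad.weakGrad_ae_eq (hΩ : IsOpen Ω) {u : Eu N → ℝ} {g : Eu N → Eu N}
    (hu : HasWeakGrad Ω u g) : weakGrad Ω u =ᵐ[volume.restrict Ω] g := by
  have h : ∃ g, HasWeakGrad Ω u g := ⟨g, hu⟩
  have hw : HasWeakGrad Ω u (weakGrad Ω u) := by
    rw [weakGrad, dif_pos h]; exact h.choose_spec
  have key := hΩ.ae_eq_zero_of_integral_contDiff_smul_eq_zero (μ := volume)
    (hw.2.1.sub hu.2.1) (fun φ h1 h2 h3 => by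
      have hφ : IsTestFun Ω φ := ⟨h1, h2, h3⟩
      rw [← setIntegral_eq_integral_of_forall_compl_eq_zero (s := Ω) (fun x hx => by
        rw [image_eq_zero_of_notMem_tsupport (fun h => hx (h3 h)), zero_smul])]
      simp only [Pi.sub_apply, smul_sub]
      rw [integral_sub (hφ.integrableOn_smul hw.2.1) (hφ.integrableOn_smul hu.2.1), sub_eq_zero]
      exact neg_injective ((hw.2.2 φ hφ).symm.trans (hu.2.2 φ hφ)))
  rw [EventuallyEq, ae_restrict_iff' hΩ.measurableSet]
  filter_upwards [key] with x hx hxΩ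
  exact sub_eq_zero.1 (hx hxΩ)

theorem MemW1.hasWeakGrad {u : Eu N → ℝ} (hu : MemW1 Ω p u) :
    HasWeakGrad Ω u (weakGrad Ω u) := by
  rw [weakGrad, dif_pos hu.1]; exact hu.1.choose_spec

theorem MemW1.weakGrad_add_smul (hΩ : IsOpen Ω) {u v : Eu N → ℝ} (hu : MemW1 Ω p u)
    (hv : MemW1 Ω p v) (c : ℝ) :
    weakGrad Ω (u + c • v) =ᵐ[volume.restrict Ω] weakGrad Ω u + c • weakGrad Ω v :=
  (hu.hasWeakGrad.add_smul hv.hasWeakGrad c).weakGrad_ae_eq hΩ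

theorem MemW10.add_smul (hΩ : IsOpen Ω) (hpm : AEMeasurable p (volume.restrict Ω))
    (hp : ∀ᵐ x ∂(volume.restrict Ω), 1 ≤ p x) {u v : Eu N → ℝ} (hu : MemW10 Ω p u)
    (hv : MemW10 Ω p v) (c : ℝ) : MemW10 Ω p (u + c • v) := by
  have hp0 : ∀ᵐ x ∂(volume.restrict Ω), 0 ≤ p x := hp.mono fun x hx => by linarith
  have hg := hu.1.weakGrad_add_smul hΩ hv.1 c
  refine ⟨⟨⟨_, hu.1.hasWeakGrad.add_smul hv.1.hasWeakGrad c⟩,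
    hu.1.2.1.add hpm hp (hv.1.2.1.smul hp0 c),
    (hu.1.2.2.add hpm hp (hv.1.2.2.smul hp0 c)).congr_ae hg.symm⟩, ?_⟩
  obtain ⟨φ, hφ, hφt⟩ := hu.2
  obtain ⟨ψ, hψ, hψt⟩ := hv.2
  refine ⟨fun k => φ k + c • ψ k, fun k => (hφ k).add_smul (hψ k) c, ?_⟩
  have hlim : Tendsto (fun k => 2 * ((luxNorm Ω p (u - φ k)
        + luxNorm Ω p (weakGrad Ω u - gradient (φ k))) + (‖c‖ₑ + 1) *
      (luxNorm Ω p (v - ψ k) + luxNorm Ω p (weakGrad Ω v - gradient (ψ k))))) atTop (𝓝 0) := by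
    have h := ENNReal.Tendsto.const_mul (a := 2) (hφt.add (ENNReal.Tendsto.const_mul
      (a := ‖c‖ₑ + 1) hψt (Or.inr (by simp)))) (Or.inr (by simp))
    simpa using h
  refine tendsto_of_tendsto_of_tendsto_of_le_of_le tendsto_const_nhds hlim (fun _ => zero_le)
    fun k => ?_
  have e1 : u + c • v - (φ k + c • ψ k) = (u - φ k) + c • (v - ψ k) := by
    rw [smul_sub]; abel
  have e2 : weakGrad Ω (u + c • v) - gradient (φ k + c • ψ k) =ᵐ[volume.restrict Ω]
      (weakGrad Ω u - gradient (φ k)) + c • (weakGrad Ω v - gradient (ψ k)) := by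
    filter_upwards [hg] with x hx
    rw [gradient_add_smul (hφ k).differentiable (hψ k).differentiable]
    simp only [Pi.sub_apply, hx, Pi.add_apply, Pi.smul_apply, smul_sub]
    abel
  have a1 : AEStronglyMeasurable (u - φ k) (volume.restrict Ω) :=
    hu.1.2.1.1.sub (hφ k).1.continuous.aestronglyMeasurable
  have a2 : AEStronglyMeasurable (weakGrad Ω u - gradient (φ k)) (volume.restrict Ω) :=
    hu.1.2.2.1.sub (hφ k).continuous_gradient.aestronglyMeasurable
  show luxNorm Ω p (u + c • v - (φ k + c • ψ k)) +
    luxNorm Ω p (weakGrad Ω (u + c • v) - gradient (φ k + c • ψ k)) ≤ _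
  rw [e1, luxNorm_congr_ae e2]
  calc _ ≤ 2 * (luxNorm Ω p (u - φ k) + (‖c‖ₑ + 1) * luxNorm Ω p (v - ψ k)) +
        2 * (luxNorm Ω p (weakGrad Ω u - gradient (φ k)) +
          (‖c‖ₑ + 1) * luxNorm Ω p (weakGrad Ω v - gradient (ψ k))) := by
        refine add_le_add ((luxNorm_add_le hpm hp a1).trans ?_)
          ((luxNorm_add_le hpm hp a2).trans ?_) <;>
        · gcongr
          exact luxNorm_smul_le hp0 _ _
    _ = _ := by ring

/-- The same test functions approximate `u` in the weaker norm. With `q = 2` this is the passage to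
`H_0^1`. -/
theorem MemW10.mono_exponent (hΩ : volume Ω ≠ ⊤) {q : Eu N → ℝ}
    (hq : ∀ᵐ x ∂(volume.restrict Ω), 1 ≤ q x) (hqp : ∀ᵐ x ∂(volume.restrict Ω), q x ≤ p x)
    {u : Eu N → ℝ} (hu : MemW10 Ω p u) : MemW10 Ω q u := by
  refine ⟨⟨hu.1.1, hu.1.2.1.mono_exponent hΩ hq hqp, hu.1.2.2.mono_exponent hΩ hq hqp⟩, ?_⟩
  obtain ⟨φ, hφ, hφt⟩ := hu.2
  obtain ⟨K, hK, h⟩ := exists_luxNorm_le_mul (F := ℝ) hΩ hq hqp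
  obtain ⟨L, hL, h'⟩ := exists_luxNorm_le_mul (F := Eu N) hΩ hq hqp
  refine ⟨φ, hφ, ?_⟩
  have hlim := ENNReal.Tendsto.const_mul (a := K + L) hφt (Or.inr (by simp [hK, hL]))
  rw [mul_zero] at hlim
  refine tendsto_of_tendsto_of_tendsto_of_le_of_le tendsto_const_nhds hlim (fun _ => zero_le)
    fun k => ?_
  refine (add_le_add (h _) (h' _)).trans ?_
  rw [mul_add]
  gcongr
  · exact le_self_add
  · exact le_add_self

/-! ### Poincaré's inequality -/

theorem IsTestFun.memLp {φ : Eu N → ℝ} (hφ : IsTestFun Ω φ) : MemLp φ 2 volume :=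
  hφ.1.continuous.memLp_of_hasCompactSupport hφ.2.1

theorem IsTestFun.memLp_gradient {φ : Eu N → ℝ} (hφ : IsTestFun Ω φ) :
    MemLp (gradient φ) 2 volume :=
  hφ.continuous_gradient.memLp_of_hasCompactSupport
    (HasCompactSupport.intro hφ.2.1 fun x hx => by
      by_contra h; exact hx (support_gradient_subset φ h))

/-- Since `∂ᵢxᵢ = 1`, integration by parts turns `∫ φ²` into `-∫ xᵢ · 2φ ∂ᵢφ`, and `|xᵢ| ≤ R`
wherever `φ ≠ 0`. -/
theorem IsTestFun.integral_sq_le (i : Fin N) {R : ℝ} (hR : ∀ x ∈ Ω, ‖x‖ ≤ R)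
    {φ : Eu N → ℝ} (hφ : IsTestFun Ω φ) :
    ∫ x, φ x ^ 2 ≤ 2 * R * ∫ x, |φ x| * ‖gradient φ x‖ := by
  let ℓ : Eu N →L[ℝ] ℝ := EuclideanSpace.proj i
  let e : Eu N := EuclideanSpace.single i 1
  have hφd := hφ.differentiable
  have hd : ∀ x, fderiv ℝ (fun x => φ x ^ 2) x e = 2 * φ x * inner ℝ (gradient φ x) e := by
    intro x
    rw [inner_gradient_left, ((hφd x).hasFDerivAt.pow 2).fderiv]
    simp
  have hℓ : ∀ x, fderiv ℝ ℓ x e = 1 := by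
    intro x; rw [ℓ.fderiv]; simp [ℓ, e]
  have hc := hφ.1.continuous
  have hgc := hφ.continuous_gradient
  have hs : ∀ g : Eu N → ℝ, Continuous g → (∀ x, φ x = 0 → g x = 0) → Integrable g volume :=
    fun g h1 h2 => h1.integrable_of_hasCompactSupport (HasCompactSupport.intro hφ.2.1
      fun x hx => h2 x (image_eq_zero_of_notMem_tsupport hx))
  have key := integral_mul_fderiv_eq_neg_fderiv_mul_of_integrable (μ := volume) (f := ℓ)
    (g := fun x => φ x ^ 2) (v := e)
    (by simp only [hℓ]; exact hs _ (by fun_prop) (fun x hx => by simp [hx]))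
    (by simp only [hd]; exact hs _ (by fun_prop) (fun x hx => by simp [hx]))
    (hs _ (by fun_prop) (fun x hx => by simp [hx]))
    (fun x _ => ℓ.differentiableAt) (fun x _ => (hφd x).pow 2)
  simp only [hℓ, hd, one_mul] at key
  rw [← neg_eq_iff_eq_neg.2 key, ← integral_neg, ← integral_const_mul]
  refine integral_mono (hs _ (by fun_prop) (fun x hx => by simp [hx]))
    (hs _ (by fun_prop) (fun x hx => by simp [hx])) fun x => ?_
  by_cases hx : φ x = 0
  · simp [hx]
  have hxR := hR x (hφ.2.2 (subset_tsupport φ hx))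
  have h1 : |ℓ x| ≤ R := (PiLp.norm_apply_le x i).trans hxR
  have h2 : |inner ℝ (gradient φ x) e| ≤ ‖gradient φ x‖ := by
    refine (abs_real_inner_le_norm _ _).trans ?_
    simp [e]
  calc -(ℓ x * (2 * φ x * inner ℝ (gradient φ x) e))
      ≤ |-(ℓ x * (2 * φ x * inner ℝ (gradient φ x) e))| := le_abs_self _
    _ = 2 * (|ℓ x| * (|φ x| * |inner ℝ (gradient φ x) e|)) := by
        rw [abs_neg, abs_mul, abs_mul, abs_mul, abs_two]; ring
    _ ≤ 2 * (R * (|φ x| * ‖gradient φ x‖)) := by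
        gcongr
        exact (abs_nonneg _).trans h1
    _ = 2 * R * (|φ x| * ‖gradient φ x‖) := by ring

/-- By Cauchy–Schwarz, `integral_sq_le` reads `‖φ‖² ≤ 2R ‖φ‖ ‖∇φ‖`, and one factor `‖φ‖` cancels
unless it is zero. -/
theorem IsTestFun.eLpNorm_le (i : Fin N) {R : ℝ≥0} (hR : ∀ x ∈ Ω, ‖x‖ ≤ R)
    {φ : Eu N → ℝ} (hφ : IsTestFun Ω φ) :
    eLpNorm φ 2 volume ≤ 2 * R * eLpNorm (gradient φ) 2 volume := by
  have h := hφ.integral_sq_le i hR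
  have hC := integral_mul_le_Lp_mul_Lq_of_nonneg (μ := volume) Real.HolderConjugate.two_two
    (f := fun x => |φ x|) (g := fun x => ‖gradient φ x‖)
    (Eventually.of_forall fun x => abs_nonneg _) (Eventually.of_forall fun x => norm_nonneg _)
    (by simpa using hφ.memLp.norm) (by simpa using hφ.memLp_gradient.norm)
  have e1 : eLpNorm φ 2 volume = ENNReal.ofReal (Real.sqrt (∫ x, φ x ^ 2)) := by
    rw [hφ.memLp.eLpNorm_eq_integral_rpow_norm (by simp) (by simp), Real.sqrt_eq_rpow]
    simp
  have e2 : eLpNorm (gradient φ) 2 volume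
      = ENNReal.ofReal (Real.sqrt (∫ x, ‖gradient φ x‖ ^ 2)) := by
    rw [hφ.memLp_gradient.eLpNorm_eq_integral_rpow_norm (by simp) (by simp), Real.sqrt_eq_rpow]
    simp
  simp only [Real.rpow_two, sq_abs, ← Real.sqrt_eq_rpow] at hC
  rw [e1, e2, show (2 * R : ℝ≥0∞) = ENNReal.ofReal (2 * R) by
    rw [ENNReal.ofReal_mul (by norm_num)]; simp, ← ENNReal.ofReal_mul (by positivity)]
  refine ENNReal.ofReal_le_ofReal ?_
  set a := Real.sqrt (∫ x, φ x ^ 2)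
  set b := Real.sqrt (∫ x, ‖gradient φ x‖ ^ 2)
  have ha : 0 ≤ a := Real.sqrt_nonneg _
  have ha2 : ∫ x, φ x ^ 2 = a * a :=
    (Real.mul_self_sqrt (integral_nonneg fun x => sq_nonneg _)).symm
  rw [ha2] at h
  have h3 : a * a ≤ (2 * R * b) * a := by
    refine h.trans ?_
    calc 2 * (R : ℝ) * ∫ x, |φ x| * ‖gradient φ x‖ ≤ 2 * R * (a * b) := by gcongr
      _ = _ := by ring
  rcases ha.eq_or_lt with h0 | h0
  · rw [← h0]; positivity
  · exact le_of_mul_le_mul_right h3 h0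

theorem eLpNorm_restrict_eq_of_support {F : Type*} [NormedAddCommGroup F] (hΩ : MeasurableSet Ω)
    {w : Eu N → F} (hw : Function.support w ⊆ Ω) (q : ℝ≥0∞) :
    eLpNorm w q (volume.restrict Ω) = eLpNorm w q volume := by
  rw [← eLpNorm_indicator_eq_eLpNorm_restrict hΩ, Set.indicator_eq_self.2 hw]

/-- Poincaré's inequality in `H_0^1(Ω)`, for bounded `Ω`. -/
theorem MemH10.eLpNorm_le (hN : 1 ≤ N) (hΩ : IsOpen Ω) {R : ℝ≥0} (hR : ∀ x ∈ Ω, ‖x‖ ≤ R)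
    {u : Eu N → ℝ} (hu : MemH10 Ω u) :
    eLpNorm u 2 (volume.restrict Ω) ≤ 2 * R * eLpNorm (weakGrad Ω u) 2 (volume.restrict Ω) := by
  obtain ⟨φ, hφ, hφt⟩ := hu.2
  set δ : ℕ → ℝ≥0∞ := fun k => luxNorm Ω (fun _ => 2) (u - φ k) +
    luxNorm Ω (fun _ => 2) (weakGrad Ω u - gradient (φ k)) with hδ
  -- The approximation error enters once through `u` and, via the inequality for `φ k`, `2R` times
  -- through the gradient.
  have hk : ∀ k, eLpNorm u 2 (volume.restrict Ω) ≤
      (1 + 2 * R) * δ k + 2 * R * eLpNorm (weakGrad Ω u) 2 (volume.restrict Ω) := by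
    intro k
    have m1 : AEStronglyMeasurable (φ k) (volume.restrict Ω) :=
      (hφ k).1.continuous.aestronglyMeasurable
    have m2 : AEStronglyMeasurable (gradient (φ k)) (volume.restrict Ω) :=
      (hφ k).continuous_gradient.aestronglyMeasurable
    have h1 : eLpNorm u 2 (volume.restrict Ω) ≤ δ k + eLpNorm (φ k) 2 (volume.restrict Ω) := by
      have := eLpNorm_add_le (p := 2) (hu.1.2.1.1.sub m1) m1 (by norm_num)
      rw [sub_add_cancel] at this
      refine this.trans ?_
      gcongr
      exact (eLpNorm_two_le_luxNorm _).trans le_self_add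
    have h2 : eLpNorm (gradient (φ k)) 2 (volume.restrict Ω) ≤
        δ k + eLpNorm (weakGrad Ω u) 2 (volume.restrict Ω) := by
      have := eLpNorm_sub_le (p := 2) hu.1.2.2.1 (hu.1.2.2.1.sub m2) (by norm_num)
      rw [sub_sub_cancel, add_comm] at this
      refine this.trans ?_
      gcongr
      exact (eLpNorm_two_le_luxNorm _).trans le_add_self
    have h3 := (hφ k).eLpNorm_le ⟨0, hN⟩ hR
    rw [← eLpNorm_restrict_eq_of_support hΩ.measurableSet
        ((subset_tsupport _).trans (hφ k).2.2),
      ← eLpNorm_restrict_eq_of_support hΩ.measurableSet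
        ((support_gradient_subset _).trans (hφ k).2.2)] at h3
    calc _ ≤ δ k + 2 * R * (δ k + eLpNorm (weakGrad Ω u) 2 (volume.restrict Ω)) := by
          refine h1.trans ?_
          gcongr
          exact h3.trans (by gcongr)
      _ = _ := by ring
  have hlim := (ENNReal.Tendsto.const_mul (a := 1 + 2 * R) hφt (Or.inr (by finiteness))).add
    (tendsto_const_nhds (x := 2 * (R : ℝ≥0∞) * eLpNorm (weakGrad Ω u) 2 (volume.restrict Ω)))
  rw [mul_zero, zero_add] at hlim
  exact ge_of_tendsto' hlim hk

end VarExp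

namespace VarExp

/-! ### Uniform convexity of `ξ ↦ |ξ|^q / q` for `q ≥ 2` -/

/-- The larger of `a` and `b` can replace the other. This serves to integrate `|w|^{p-2} w · z`. -/
theorem rpow_sub_one_mul_le {q : ℝ} (hq : 1 ≤ q) {a b : ℝ} (ha : 0 ≤ a) (hb : 0 ≤ b) :
    a ^ (q - 1) * b ≤ a ^ q + b ^ q := by
  have e : ∀ c : ℝ, 0 ≤ c → c ^ (q - 1) * c = c ^ q := fun c hc => by
    rw [← Real.rpow_add_one' hc (by linarith)]
    ring_nf
  rcases le_total a b with h | h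
  · calc a ^ (q - 1) * b ≤ b ^ (q - 1) * b := by gcongr
      _ = b ^ q := e b hb
      _ ≤ _ := le_add_of_nonneg_left (by positivity)
  · calc a ^ (q - 1) * b ≤ a ^ (q - 1) * a := by gcongr
      _ = a ^ q := e a ha
      _ ≤ _ := le_add_of_nonneg_right (by positivity)

section Pointwise

variable {E : Type*} [NormedAddCommGroup E] [InnerProductSpace ℝ E]

theorem norm_rpow_sub_two_smul {q : ℝ} (hq : 2 ≤ q) (a : E) :
    ‖‖a‖ ^ (q - 2) • a‖ = ‖a‖ ^ (q - 1) := by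
  rw [norm_smul, Real.norm_of_nonneg (by positivity),
    ← Real.rpow_add_one' (norm_nonneg _) (by linarith)]
  ring_nf

theorem inner_rpow_smul_self {q : ℝ} (hq : 2 ≤ q) (a : E) :
    inner ℝ (‖a‖ ^ (q - 2) • a) a = ‖a‖ ^ q := by
  rw [real_inner_smul_left, real_inner_self_eq_norm_sq, ← Real.rpow_two,
    ← Real.rpow_add' (norm_nonneg _) (by linarith)]
  ring_nf

theorem abs_inner_rpow_smul_le {q : ℝ} (hq : 2 ≤ q) (a b : E) :
    |inner ℝ (‖a‖ ^ (q - 2) • a) b| ≤ ‖a‖ ^ q + ‖b‖ ^ q := by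
  refine (abs_real_inner_le_norm _ _).trans ?_
  rw [norm_rpow_sub_two_smul hq]
  exact rpow_sub_one_mul_le (by linarith) (norm_nonneg _) (norm_nonneg _)

/-- Young's inequality for `‖a‖^{q-1} ‖b‖` with the exponents `q/(q-1)` and `q`. -/
theorem norm_rpow_div_subgradient {q : ℝ} (hq : 2 ≤ q) (a b : E) :
    ‖a‖ ^ q / q + inner ℝ (‖a‖ ^ (q - 2) • a) (b - a) ≤ ‖b‖ ^ q / q := by
  have hq0 : q ≠ 0 := by linarith
  have hc : (q / (q - 1)).HolderConjugate q :=
    (Real.HolderConjugate.conjExponent (by linarith)).symm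
  have h1 : inner ℝ (‖a‖ ^ (q - 2) • a) b ≤ ‖a‖ ^ (q - 1) * ‖b‖ := by
    refine (real_inner_le_norm _ _).trans_eq ?_
    rw [norm_rpow_sub_two_smul hq]
  have h2 := Real.young_inequality_of_nonneg (a := ‖a‖ ^ (q - 1)) (b := ‖b‖) (by positivity)
    (norm_nonneg _) hc
  have hq1 : q - 1 ≠ 0 := by linarith
  rw [← Real.rpow_mul (norm_nonneg _), mul_div_cancel₀ _ hq1] at h2
  have h3 : ‖a‖ ^ q / (q / (q - 1)) = ‖a‖ ^ q - ‖a‖ ^ q / q := by field_simp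
  rw [inner_sub_right, inner_rpow_smul_self hq]
  linarith

/-- Clarkson's inequality. -/
theorem clarkson_rpow {q : ℝ} (hq : 2 ≤ q) (a b : E) :
    ‖(1 / 2 : ℝ) • (a + b)‖ ^ q + ‖(1 / 2 : ℝ) • (a - b)‖ ^ q ≤ (‖a‖ ^ q + ‖b‖ ^ q) / 2 := by
  -- The parallelogram law settles `q = 2`; the power `q / 2 ≥ 1` is superadditive on the left side
  -- and convex on the right.
  have hr : 1 ≤ q / 2 := by linarith
  have e : ∀ z : E, ‖z‖ ^ q = (‖z‖ ^ 2) ^ (q / 2) := fun z => by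
    rw [← Real.rpow_natCast_mul (norm_nonneg _)]; congr 1; push_cast; ring
  have hpar : ‖(1 / 2 : ℝ) • (a + b)‖ ^ 2 + ‖(1 / 2 : ℝ) • (a - b)‖ ^ 2
      = 1 / 2 * ‖a‖ ^ 2 + 1 / 2 * ‖b‖ ^ 2 := by
    have := parallelogram_law_with_norm ℝ a b
    simp only [norm_smul, mul_pow]
    norm_num
    nlinarith
  have h1 := Real.add_rpow_le_rpow_add (sq_nonneg ‖(1 / 2 : ℝ) • (a + b)‖)
    (sq_nonneg ‖(1 / 2 : ℝ) • (a - b)‖) hr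
  have h2 := (convexOn_rpow hr).2 (Set.mem_Ici.2 (sq_nonneg ‖a‖)) (Set.mem_Ici.2 (sq_nonneg ‖b‖))
    (by norm_num : (0 : ℝ) ≤ 1 / 2) (by norm_num : (0 : ℝ) ≤ 1 / 2) (by norm_num)
  simp only [smul_eq_mul] at h2
  rw [hpar] at h1
  rw [e, e, e a, e b]
  linarith

/-- Twice the subgradient inequality between `a` and the midpoint `(a + b) / 2`; Clarkson's
inequality bounds the midpoint value by the average and leaves the extra term. -/
theorem norm_rpow_div_uniformConvex {q : ℝ} (hq : 2 ≤ q) (a b : E) :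
    ‖a‖ ^ q / q + inner ℝ (‖a‖ ^ (q - 2) • a) (b - a) + 2 / q * ‖(1 / 2 : ℝ) • (a - b)‖ ^ q
      ≤ ‖b‖ ^ q / q := by
  have h1 := norm_rpow_div_subgradient hq a ((1 / 2 : ℝ) • (a + b))
  have h2 := clarkson_rpow hq a b
  have e : (1 / 2 : ℝ) • (a + b) - a = (1 / 2 : ℝ) • (b - a) := by
    module
  rw [e, inner_smul_right] at h1
  have hq0 : 0 < q := by linarith
  have h3 := mul_le_mul_of_nonneg_left h2 (by positivity : 0 ≤ 2 / q)
  have e1 : 2 / q * (‖(1 / 2 : ℝ) • (a + b)‖ ^ q + ‖(1 / 2 : ℝ) • (a - b)‖ ^ q) =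
    2 * (‖(1 / 2 : ℝ) • (a + b)‖ ^ q / q) + 2 / q * ‖(1 / 2 : ℝ) • (a - b)‖ ^ q := by ring
  have e2 : 2 / q * ((‖a‖ ^ q + ‖b‖ ^ q) / 2) = ‖a‖ ^ q / q + ‖b‖ ^ q / q := by ring
  rw [e1, e2] at h3
  linarith

theorem inner_rpow_smul_monotone {q : ℝ} (hq : 2 ≤ q) (a b : E) :
    0 ≤ inner ℝ (‖a‖ ^ (q - 2) • a - ‖b‖ ^ (q - 2) • b) (a - b) := by
  have h1 := norm_rpow_div_subgradient hq a b
  have h2 := norm_rpow_div_subgradient hq b a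
  rw [← neg_sub a b, inner_neg_right] at h1
  rw [inner_sub_left]
  linarith

theorem norm_rpow_div_convex {q : ℝ} (hq : 1 ≤ q) (a b : E) {t : ℝ} (h0 : 0 ≤ t) (h1 : t ≤ 1) :
    ‖a + t • (b - a)‖ ^ q / q ≤ ‖a‖ ^ q / q + t * (‖b‖ ^ q / q - ‖a‖ ^ q / q) := by
  have h2 := (convexOn_rpow hq).2 (Set.mem_Ici.2 (norm_nonneg a)) (Set.mem_Ici.2 (norm_nonneg b))
    (sub_nonneg.2 h1) h0 (by ring)
  simp only [smul_eq_mul] at h2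
  have h3 : ‖a + t • (b - a)‖ ≤ (1 - t) * ‖a‖ + t * ‖b‖ := by
    rw [show a + t • (b - a) = (1 - t) • a + t • b by module]
    refine (norm_add_le _ _).trans_eq ?_
    rw [norm_smul, norm_smul, Real.norm_of_nonneg (sub_nonneg.2 h1), Real.norm_of_nonneg h0]
  have h4 := (Real.rpow_le_rpow (norm_nonneg _) h3 (by linarith : 0 ≤ q)).trans h2
  have hq0 : 0 < q := by linarith
  calc _ ≤ ((1 - t) * ‖a‖ ^ q + t * ‖b‖ ^ q) / q := by gcongr
    _ = _ := by ring

end Pointwise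

/-! ### Convergence of the iteration in a Hilbert space -/

theorem tendsto_zero_of_le_sub_succ {a b : ℕ → ℝ} (ha : ∀ n, 0 ≤ a n) (hb : ∀ n, 0 ≤ b n)
    (h : ∀ n, b n ≤ a n - a (n + 1)) : Tendsto b atTop (𝓝 0) := by
  have hs : Summable b := summable_of_sum_range_le (c := a 0) hb fun n => by
    calc ∑ i ∈ Finset.range n, b i ≤ ∑ i ∈ Finset.range n, (a i - a (i + 1)) :=
          Finset.sum_le_sum fun i _ => h i
      _ = a 0 - a n := Finset.sum_range_sub' a n
      _ ≤ a 0 := by linarith [ha n]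
  exact hs.tendsto_atTop_zero

theorem bounded_of_eventually_le {b : ℕ → ℝ} {k : ℕ} {B : ℝ} (h : ∀ n, k ≤ n → b n ≤ B) :
    ∃ C, ∀ n, b n ≤ C := by
  have := (isBoundedUnder_of_eventually_le (f := atTop) (u := b) (a := B)
    (eventually_atTop.2 ⟨k, h⟩)).bddAbove_range
  exact ⟨_, fun n => this.choose_spec ⟨n, rfl⟩⟩

section Hilbert

variable {H : Type*} [NormedAddCommGroup H] [InnerProductSpace ℝ H]

/-- Errors of the decomposition-coordination iteration: multipliers `E n`, gradients `U n`,
auxiliary fields `V n`, and a convexity gain `M n`. -/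
structure ErrorRelations (r : ℝ) (E U V : ℕ → H) (M : ℕ → ℝ) : Prop where
  step_a : ∀ n, 1 ≤ n → inner ℝ (E n + r • (U n - V (n - 1))) (U n) ≤ 0
  step_b : ∀ n, 1 ≤ n → M n + inner ℝ (-E n + r • (V n - U n)) (V n) ≤ 0
  step_c : ∀ n, 1 ≤ n → E (n + 1) = E n + r • (U n - V n)
  mono : ∀ n, 1 ≤ n → inner ℝ (V (n + 1) - U (n + 1)) (V (n + 1) - V n) ≤ 0
  gain_nonneg : ∀ n, 0 ≤ M n

variable {r : ℝ} {E U V : ℕ → H} {M : ℕ → ℝ}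

/-- Let `e, u, v` be the errors at `n + 1` and `w = V n`. Adding (a) and (b) gives `⟨e, u - v⟩ ≤
-r‖u - v‖² - r⟨v - w, u⟩`. By `mono`, `⟨v - w, u⟩ ≥ ⟨v - w, v⟩`, and `2⟨v - w, v⟩ = ‖v‖² - ‖w‖² + ‖v
- w‖²`. Insert this in the expansion of `‖e + r (u - v)‖²`. Since `mono` compares two consecutive
steps (b), the decay starts at the second iterate. -/
theorem ErrorRelations.energy_decay (h : ErrorRelations r E U V M) (hr : 0 < r) {n : ℕ}
    (hn : 1 ≤ n) :
    r ^ 2 * ‖U (n + 1) - V (n + 1)‖ ^ 2 + r ^ 2 * ‖V (n + 1) - V n‖ ^ 2 ≤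
      (‖E (n + 1)‖ ^ 2 + r ^ 2 * ‖V n‖ ^ 2) -
        (‖E (n + 1 + 1)‖ ^ 2 + r ^ 2 * ‖V (n + 1)‖ ^ 2) := by
  have ha := h.step_a (n + 1) (by omega)
  have hb := h.step_b (n + 1) (by omega)
  have hM := h.gain_nonneg (n + 1)
  have hd := h.mono n hn
  rw [h.step_c (n + 1) (by omega)]
  simp only [Nat.add_sub_cancel] at ha
  generalize E (n + 1) = e at *
  generalize U (n + 1) = u at *
  generalize V (n + 1) = v at *
  generalize V n = w at *
  simp only [← real_inner_self_eq_norm_sq, inner_add_left, inner_add_right, inner_sub_left,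
    inner_sub_right, real_inner_smul_left, real_inner_smul_right, inner_neg_left] at *
  rw [real_inner_comm e u, real_inner_comm e v, real_inner_comm u v, real_inner_comm w v] at *
  rw [real_inner_comm w u] at *
  have h1 := mul_le_mul_of_nonneg_left ha hr.le
  have h2 := mul_le_mul_of_nonneg_left hb hr.le
  have h3 := mul_le_mul_of_nonneg_left hM hr.le
  have h4 := mul_le_mul_of_nonneg_left hd (sq_nonneg r)
  nlinarith

theorem ErrorRelations.tendsto (h : ErrorRelations r E U V M) (hr : 0 < r) :
    Tendsto (fun n => U n - V n) atTop (𝓝 0) ∧ Tendsto M atTop (𝓝 0) ∧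
      ∃ C, ∀ n, ‖E n‖ ≤ C := by
  have hr2 : 0 < r ^ 2 := by positivity
  have hdec := fun n => h.energy_decay hr (n := n + 1) (by omega)
  set a : ℕ → ℝ := fun n => ‖E (n + 2)‖ ^ 2 + r ^ 2 * ‖V (n + 1)‖ ^ 2 with ha
  have hT := tendsto_zero_of_le_sub_succ (a := a) (fun n => by positivity)
    (fun n => by positivity) hdec
  have hanti : Antitone a := antitone_nat_of_succ_le fun n => by
    have h1 := hdec n
    have h2 : 0 ≤ r ^ 2 * ‖U (n + 1 + 1) - V (n + 1 + 1)‖ ^ 2 +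
      r ^ 2 * ‖V (n + 1 + 1) - V (n + 1)‖ ^ 2 := by positivity
    have h3 : a (n + 1) = ‖E (n + 1 + 1 + 1)‖ ^ 2 + r ^ 2 * ‖V (n + 1 + 1)‖ ^ 2 := rfl
    have h4 : a n = ‖E (n + 1 + 1)‖ ^ 2 + r ^ 2 * ‖V (n + 1)‖ ^ 2 := rfl
    linarith
  have hle : ∀ n, a n ≤ a 0 := fun n => hanti (Nat.zero_le n)
  have sqT : ∀ {b : ℕ → H}, (∀ n, r ^ 2 * ‖b n‖ ^ 2 ≤
      r ^ 2 * ‖U (n + 1 + 1) - V (n + 1 + 1)‖ ^ 2 +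
      r ^ 2 * ‖V (n + 1 + 1) - V (n + 1)‖ ^ 2) → Tendsto b atTop (𝓝 0) := by
    intro b hb
    have h1 : Tendsto (fun n => r ^ 2 * ‖b n‖ ^ 2) atTop (𝓝 0) :=
      squeeze_zero (fun n => by positivity) hb hT
    have h2 := (h1.const_mul (r ^ 2)⁻¹).sqrt
    simp only [inv_mul_cancel_left₀ hr2.ne', Real.sqrt_sq (norm_nonneg _), mul_zero,
      Real.sqrt_zero] at h2
    exact tendsto_zero_iff_norm_tendsto_zero.2 h2
  have hUV : Tendsto (fun n => U n - V n) atTop (𝓝 0) :=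
    (tendsto_add_atTop_iff_nat 2).1 (sqT (b := fun n => U (n + 2) - V (n + 2)) fun n =>
      le_add_of_nonneg_right (by positivity))
  have hVV : Tendsto (fun n => V (n + 1) - V n) atTop (𝓝 0) :=
    (tendsto_add_atTop_iff_nat 1).1 (sqT (b := fun n => V (n + 1 + 1) - V (n + 1)) fun n =>
      le_add_of_nonneg_left (by positivity))
  -- The sequence `a` controls `E` only from index 2 on and `V` from index 1 on; the finitely many
  -- earlier terms merely enlarge the bound.
  obtain ⟨C, hC⟩ : ∃ C, ∀ n, ‖E n‖ ≤ C := bounded_of_eventually_le (k := 2)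
    (B := Real.sqrt (a 0)) fun n hn => by
      obtain ⟨k, rfl⟩ := Nat.exists_eq_add_of_le' hn
      exact Real.le_sqrt_of_sq_le ((le_add_of_nonneg_right (by positivity)).trans (hle k))
  obtain ⟨D, hD⟩ : ∃ D, ∀ n, ‖V n‖ ≤ D := bounded_of_eventually_le (k := 1)
    (B := Real.sqrt (a 0 / r ^ 2)) fun n hn => by
      obtain ⟨k, rfl⟩ := Nat.exists_eq_add_of_le' hn
      refine Real.le_sqrt_of_sq_le ((le_div_iff₀' hr2).2 ?_)
      exact (le_add_of_nonneg_left (by positivity)).trans (hle k)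
  refine ⟨hUV, ?_, C, hC⟩
  have hUV0 := hUV.norm
  have hVV0 := hVV.norm
  rw [norm_zero] at hUV0 hVV0
  have hlim : Tendsto (fun n => C * ‖U (n + 1) - V (n + 1)‖ +
      r * ‖U (n + 1) - V (n + 1)‖ * D + r * (‖U (n + 1) - V (n + 1)‖ + ‖V (n + 1) - V n‖) *
        (‖U (n + 1) - V (n + 1)‖ + D)) atTop (𝓝 0) := by
    have h1 := (tendsto_add_atTop_iff_nat 1).2 hUV0
    have := ((h1.const_mul C).add ((h1.const_mul r).mul_const D)).add
      (((h1.add hVV0).const_mul r).mul (h1.add_const D))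
    simpa using this
  refine (tendsto_add_atTop_iff_nat 1).1
    (squeeze_zero (fun n => h.gain_nonneg _) (fun n => ?_) hlim)
  have ha := h.step_a (n + 1) (by omega)
  have hb := h.step_b (n + 1) (by omega)
  simp only [Nat.add_sub_cancel] at ha
  have hE := hC (n + 1)
  have hV := hD (n + 1)
  generalize E (n + 1) = e at *
  generalize U (n + 1) = u at *
  generalize V (n + 1) = v at *
  generalize V n = w at *
  -- The sum of (a) and (b) bounds `M` by the negative of this expression. Each term pairs a bounded
  -- vector with `u - v` or `u - w = (u - v) + (v - w)`, both of which tend to zero.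
  have e1 : inner ℝ (e + r • (u - w)) u + inner ℝ (-e + r • (v - u)) v =
      inner ℝ e (u - v) - r * inner ℝ (u - v) v + r * inner ℝ (u - w) u := by
    simp only [inner_add_left, inner_sub_left,
      inner_sub_right, real_inner_smul_left, inner_neg_left]
    ring
  have i1 := neg_le_of_abs_le (abs_real_inner_le_norm e (u - v))
  have i2 := real_inner_le_norm (u - v) v
  have i3 := neg_le_of_abs_le (abs_real_inner_le_norm (u - w) u)
  have n1 : ‖u - w‖ ≤ ‖u - v‖ + ‖v - w‖ := by simpa using norm_add_le (u - v) (v - w)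
  have n2 : ‖u‖ ≤ ‖u - v‖ + D := by
    have := norm_add_le (u - v) v
    rw [sub_add_cancel] at this
    linarith
  have j1 : ‖e‖ * ‖u - v‖ ≤ C * ‖u - v‖ := by gcongr
  have j2 : r * (‖u - v‖ * ‖v‖) ≤ r * (‖u - v‖ * D) := by gcongr
  have j3 : r * (‖u - w‖ * ‖u‖) ≤ r * ((‖u - v‖ + ‖v - w‖) * (‖u - v‖ + D)) := by gcongr
  have k2 := mul_le_mul_of_nonneg_left i2 hr.le
  have k3 := mul_le_mul_of_nonneg_left i3 hr.le
  linarith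

end Hilbert

end VarExp

namespace VarExp

/-! ### Square integrable fields as elements of a Hilbert space -/

section ToL2

variable {α E : Type*} [MeasurableSpace α] [NormedAddCommGroup E] {μ : Measure α}

open Classical in
/-- The class of `w` in `L²`, with the value `0` if `w` is not square integrable. -/
noncomputable def toL2 (μ : Measure α) (w : α → E) : Lp E 2 μ :=
  if h : MemLp w 2 μ then h.toLp w else 0

theorem toL2_eq {w : α → E} (h : MemLp w 2 μ) : toL2 μ w = h.toLp w := dif_pos h

theorem toL2_add {w z : α → E} (hw : MemLp w 2 μ) (hz : MemLp z 2 μ) :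
    toL2 μ (w + z) = toL2 μ w + toL2 μ z := by
  rw [toL2_eq hw, toL2_eq hz, toL2_eq (hw.add hz)]; rfl

theorem toL2_sub {w z : α → E} (hw : MemLp w 2 μ) (hz : MemLp z 2 μ) :
    toL2 μ (w - z) = toL2 μ w - toL2 μ z := by
  rw [toL2_eq hw, toL2_eq hz, toL2_eq (hw.sub hz)]; rfl

theorem toL2_neg {w : α → E} (hw : MemLp w 2 μ) : toL2 μ (-w) = -toL2 μ w := by
  rw [toL2_eq hw, toL2_eq hw.neg]; rfl

theorem toL2_congr {w z : α → E} (hw : MemLp w 2 μ) (h : w =ᵐ[μ] z) :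
    toL2 μ w = toL2 μ z := by
  rw [toL2_eq hw, toL2_eq ((memLp_congr_ae h).1 hw)]
  exact MemLp.toLp_congr _ _ h

theorem enorm_toL2 {w : α → E} (hw : MemLp w 2 μ) : ‖toL2 μ w‖ₑ = eLpNorm w 2 μ := by
  rw [toL2_eq hw, Lp.enorm_toLp]

variable [InnerProductSpace ℝ E]

theorem toL2_smul {w : α → E} (hw : MemLp w 2 μ) (c : ℝ) : toL2 μ (c • w) = c • toL2 μ w := by
  rw [toL2_eq hw, toL2_eq (hw.const_smul c)]; rfl

theorem inner_toL2 {w z : α → E} (hw : MemLp w 2 μ) (hz : MemLp z 2 μ) :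
    inner ℝ (toL2 μ w) (toL2 μ z) = ∫ x, inner ℝ (w x) (z x) ∂μ := by
  rw [toL2_eq hw, toL2_eq hz, L2.inner_def]
  refine integral_congr_ae ?_
  filter_upwards [hw.coeFn_toLp, hz.coeFn_toLp] with x h1 h2
  rw [h1, h2]

theorem integrable_inner_of_memLp_two {w z : α → E} (hw : MemLp w 2 μ) (hz : MemLp z 2 μ) :
    Integrable (fun x => inner ℝ (w x) (z x)) μ := by
  refine (L2.integrable_inner (𝕜 := ℝ) (hw.toLp w) (hz.toLp z)).congr ?_
  filter_upwards [hw.coeFn_toLp, hz.coeFn_toLp] with x h1 h2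
  rw [h1, h2]

theorem integral_norm_sq_eq {w : α → E} (hw : MemLp w 2 μ) :
    ∫ x, ‖w x‖ ^ 2 ∂μ = ‖toL2 μ w‖ ^ 2 := by
  rw [← real_inner_self_eq_norm_sq, inner_toL2 hw hw]
  simp only [real_inner_self_eq_norm_sq]

end ToL2

/-! ### Variational inequalities at a saddle point -/

/-- Standing assumptions on the domain and on the exponent. -/
structure AdmissibleExponent {N : ℕ} (Ω : Set (Eu N)) (p : Eu N → ℝ) : Prop where
  isOpen : IsOpen Ω
  finite : volume Ω ≠ ⊤
  meas : AEMeasurable p (volume.restrict Ω)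
  two_le : ∀ᵐ x ∂(volume.restrict Ω), 2 ≤ p x
  bdd : ∃ P : ℝ, ∀ᵐ x ∂(volume.restrict Ω), p x ≤ P

variable {N : ℕ} {Ω : Set (Eu N)} {p : Eu N → ℝ} {f : Eu N → ℝ} {r : ℝ}

namespace AdmissibleExponent

theorem one_le (hp : AdmissibleExponent Ω p) : ∀ᵐ x ∂(volume.restrict Ω), 1 ≤ p x :=
  hp.two_le.mono fun x hx => by linarith

theorem nonneg (hp : AdmissibleExponent Ω p) : ∀ᵐ x ∂(volume.restrict Ω), 0 ≤ p x :=
  hp.two_le.mono fun x hx => by linarith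

theorem memVarLp_add_smul (hp : AdmissibleExponent Ω p) {w z : Eu N → Eu N}
    (hw : MemVarLp Ω p w) (hz : MemVarLp Ω p z) (c : ℝ) : MemVarLp Ω p (w + c • z) :=
  hw.add hp.meas hp.one_le (hz.smul hp.nonneg c)

theorem memVarLp_sub (hp : AdmissibleExponent Ω p) {w z : Eu N → Eu N}
    (hw : MemVarLp Ω p w) (hz : MemVarLp Ω p z) : MemVarLp Ω p (w - z) := by
  simpa [sub_eq_add_neg] using hp.memVarLp_add_smul hw hz (-1)

theorem memLp_two (hp : AdmissibleExponent Ω p) {w : Eu N → Eu N} (hw : MemVarLp Ω p w) :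
    MemLp w 2 (volume.restrict Ω) :=
  hw.memLp_two hp.finite hp.two_le

theorem integrable_inner (hp : AdmissibleExponent Ω p) {a b : Eu N → Eu N}
    (ha : MemVarLp Ω (conjExp p) a) (hb : MemVarLp Ω p b) :
    Integrable (fun x => inner ℝ (a x) (b x)) (volume.restrict Ω) :=
  integrable_inner_of_memVarLp hp.meas hp.two_le hp.bdd ha hb

theorem integrable_rpow (hp : AdmissibleExponent Ω p) {w : Eu N → Eu N}
    (hw : MemVarLp Ω p w) : Integrable (fun x => ‖w x‖ ^ p x) (volume.restrict Ω) :=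
  hw.integrable_rpow hp.meas hp.nonneg hp.bdd

theorem integrable_rpow_div (hp : AdmissibleExponent Ω p) {w : Eu N → Eu N}
    (hw : MemVarLp Ω p w) : Integrable (fun x => ‖w x‖ ^ p x / p x) (volume.restrict Ω) := by
  have h := hp.integrable_rpow hw
  refine h.mono' (h.1.aemeasurable.div hp.meas).aestronglyMeasurable ?_
  filter_upwards [hp.two_le] with x hx
  rw [Real.norm_of_nonneg (by positivity)]
  exact div_le_self (by positivity) (by linarith)

theorem integrable_inner_rpow (hp : AdmissibleExponent Ω p) {w z : Eu N → Eu N}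
    (hw : MemVarLp Ω p w) (hz : MemVarLp Ω p z) :
    Integrable (fun x => inner ℝ (‖w x‖ ^ (p x - 2) • w x) (z x)) (volume.restrict Ω) := by
  refine ((hp.integrable_rpow hw).add (hp.integrable_rpow hz)).mono' ?_ ?_
  · exact ((hw.1.norm.aemeasurable.pow (hp.meas.sub_const 2)).aestronglyMeasurable.smul
      hw.1).inner hz.1
  · filter_upwards [hp.two_le] with x hx
    exact abs_inner_rpow_smul_le hx _ _

theorem memW10_segment (hp : AdmissibleExponent Ω p) {u v : Eu N → ℝ} (hu : MemW10 Ω p u)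
    (hv : MemW10 Ω p v) (t : ℝ) : MemW10 Ω p (u + t • (v - u)) := by
  have h := (hu.add_smul hp.isOpen hp.meas hp.one_le
    (hv.add_smul hp.isOpen hp.meas hp.one_le hu (-1)) t)
  simpa [sub_eq_add_neg] using h

theorem weakGrad_sub (hp : AdmissibleExponent Ω p) {u v : Eu N → ℝ} (hu : MemW10 Ω p u)
    (hv : MemW10 Ω p v) :
    weakGrad Ω (v - u) =ᵐ[volume.restrict Ω] weakGrad Ω v - weakGrad Ω u := by
  simpa [sub_eq_add_neg] using hv.1.weakGrad_add_smul hp.isOpen hu.1 (-1)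

theorem memW10_sub (hp : AdmissibleExponent Ω p) {u v : Eu N → ℝ} (hu : MemW10 Ω p u)
    (hv : MemW10 Ω p v) : MemW10 Ω p (v - u) := by
  simpa [sub_eq_add_neg] using hv.add_smul hp.isOpen hp.meas hp.one_le hu (-1)

theorem weakGrad_segment (hp : AdmissibleExponent Ω p) {u v : Eu N → ℝ} (hu : MemW10 Ω p u)
    (hv : MemW10 Ω p v) (t : ℝ) : weakGrad Ω (u + t • (v - u)) =ᵐ[volume.restrict Ω]
      weakGrad Ω u + t • (weakGrad Ω v - weakGrad Ω u) := by
  filter_upwards [hu.1.weakGrad_add_smul hp.isOpen (hp.memW10_sub hu hv).1 t,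
    hp.weakGrad_sub hu hv] with x h1 h2
  simp only [h1, Pi.add_apply, Pi.smul_apply, h2]

/-- The integral in the third term of `augLagrangian` extends over the penalty term as well, which
therefore carries the factor `|Ω|`. -/
theorem augLagrangian_eq (hp : AdmissibleExponent Ω p) {v : Eu N → ℝ} {ν η : Eu N → Eu N}
    (hv : MemW10 Ω p v) (hν : MemVarLp Ω p ν) (hη : MemVarLp Ω (conjExp p) η) :
    augLagrangian Ω p f r v ν η = energyF Ω p ν + energyG Ω f v
      + (∫ x in Ω, inner ℝ (η x) (weakGrad Ω v x - ν x))
      + volume.real Ω * (r / 2) * ∫ x in Ω, ‖weakGrad Ω v x - ν x‖ ^ 2 := by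
  have := isFiniteMeasure_restrict.2 hp.finite
  have i1 : Integrable (fun x => inner ℝ (η x) (weakGrad Ω v x - ν x)) (volume.restrict Ω) :=
    hp.integrable_inner hη (hp.memVarLp_sub hv.1.2.2 hν)
  rw [augLagrangian, integral_add i1 (integrable_const _), integral_const]
  simp only [measureReal_restrict_apply_univ, smul_eq_mul]
  ring

end AdmissibleExponent

/-- Divide by `t` and let `t → 0⁺`: a first variation survives, while quadratic terms vanish
whatever their coefficient. -/
theorem nonneg_of_forall_add_mul_sq {X Y : ℝ}
    (h : ∀ t : ℝ, 0 < t → t ≤ 1 → 0 ≤ t * X + t ^ 2 * Y) : 0 ≤ X := by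
  have hlim : Tendsto (fun t : ℝ => X + t * Y) (𝓝[>] 0) (𝓝 X) := by
    have : Tendsto (fun t : ℝ => X + t * Y) (𝓝 0) (𝓝 (X + 0 * Y)) := by
      apply Continuous.tendsto; fun_prop
    rw [zero_mul, add_zero] at this
    exact this.mono_left nhdsWithin_le_nhds
  refine ge_of_tendsto hlim ?_
  filter_upwards [Ioo_mem_nhdsGT (zero_lt_one (α := ℝ))] with t ht
  have h1 := h t ht.1 ht.2.le
  rw [show t * X + t ^ 2 * Y = t * (X + t * Y) by ring] at h1
  exact nonneg_of_mul_nonneg_right h1 ht.1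

namespace IsSaddlePoint

variable {us : Eu N → ℝ} {νs ηs : Eu N → Eu N}

/-- The multiplier `ηs + (∇us - νs)` is admissible because `p' ≤ 2 ≤ p`. It changes only the pairing
term, by `‖∇us - νs‖²`, which the left inequality forces to be nonpositive. -/
theorem weakGrad_ae_eq (hs : IsSaddlePoint Ω p f r us νs ηs) (hp : AdmissibleExponent Ω p) :
    weakGrad Ω us =ᵐ[volume.restrict Ω] νs := by
  have hD : MemVarLp Ω p (weakGrad Ω us - νs) := hp.memVarLp_sub hs.mem_u.1.2.2 hs.mem_ν
  have hq : ∀ᵐ x ∂(volume.restrict Ω), 1 ≤ conjExp p x :=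
    hp.two_le.mono fun x hx => (holderConjugate_conjExp hx).symm.lt.le
  have hD' : MemVarLp Ω (conjExp p) (weakGrad Ω us - νs) :=
    hD.mono_exponent hp.finite hq (hp.two_le.mono fun x hx => (conjExp_le_two hx).trans hx)
  have hη := hs.mem_η.add (aemeasurable_conjExp hp.meas) hq hD'
  have h := hs.le_left _ hη
  have h2 := hp.memLp_two hD
  have i1 := hp.integrable_inner hs.mem_η hD
  have i2 := integrable_inner_of_memLp_two h2 h2
  have e : ∫ x in Ω, inner ℝ ((ηs + (weakGrad Ω us - νs)) x) (weakGrad Ω us x - νs x) =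
      (∫ x in Ω, inner ℝ (ηs x) (weakGrad Ω us x - νs x)) +
        ∫ x in Ω, inner ℝ ((weakGrad Ω us - νs) x) ((weakGrad Ω us - νs) x) := by
    simp only [Pi.sub_apply] at i1 i2 ⊢
    rw [← integral_add i1 i2]
    simp only [Pi.add_apply, Pi.sub_apply, inner_add_left]
  rw [hp.augLagrangian_eq hs.mem_u hs.mem_ν hη, hp.augLagrangian_eq hs.mem_u hs.mem_ν hs.mem_η]
    at h
  rw [e, ← inner_toL2 h2 h2, real_inner_self_eq_norm_sq] at h
  have h3 : toL2 (volume.restrict Ω) (weakGrad Ω us - νs) = 0 := by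
    rw [← norm_eq_zero, ← sq_eq_zero_iff]
    exact le_antisymm (by linarith) (sq_nonneg _)
  have h4 := enorm_toL2 h2
  rw [h3, enorm_zero, eq_comm, eLpNorm_eq_zero_iff h2.1 (by norm_num)] at h4
  filter_upwards [h4] with x hx
  exact sub_eq_zero.1 hx

/-- First variation along the segment from `us` to `v`, with `νs` fixed. Because `∇us = νs`, the
penalty is purely quadratic in `t`, so its factor `|Ω|` does not matter. -/
theorem variational_left (hs : IsSaddlePoint Ω p f r us νs ηs) (hp : AdmissibleExponent Ω p)
    (hf : ∀ v : Eu N → ℝ, MemW10 Ω p v → IntegrableOn (fun x => f x * v x) Ω)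
    {v : Eu N → ℝ} (hv : MemW10 Ω p v) :
    0 ≤ (∫ x in Ω, f x * (us x - v x)) +
      ∫ x in Ω, inner ℝ (ηs x) (weakGrad Ω v x - weakGrad Ω us x) := by
  have hgrad := hs.weakGrad_ae_eq hp
  refine nonneg_of_forall_add_mul_sq
    (Y := volume.real Ω * (r / 2) * ∫ x in Ω, ‖weakGrad Ω v x - weakGrad Ω us x‖ ^ 2) fun t _ _ => ?_
  have h := hs.le_right _ νs (hp.memW10_segment hs.mem_u hv t) hs.mem_ν
  have hseg := hp.weakGrad_segment hs.mem_u hv t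
  rw [hp.augLagrangian_eq hs.mem_u hs.mem_ν hs.mem_η, hp.augLagrangian_eq
    (hp.memW10_segment hs.mem_u hv t) hs.mem_ν hs.mem_η, energyG, energyG] at h
  have g1 : ∫ x in Ω, f x * (us + t • (v - us)) x =
      (∫ x in Ω, f x * us x) - t * ∫ x in Ω, f x * (us x - v x) := by
    have i1 : IntegrableOn (fun x => f x * (us x - v x)) Ω := by
      simp only [mul_sub]
      exact (hf us hs.mem_u).sub (hf v hv)
    rw [← integral_const_mul, ← integral_sub (hf us hs.mem_u) (i1.const_mul t)]
    refine integral_congr_ae (Eventually.of_forall fun x => ?_)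
    simp only [Pi.add_apply, Pi.smul_apply, Pi.sub_apply, smul_eq_mul]
    ring
  have g2 : ∫ x in Ω, inner ℝ (ηs x) (weakGrad Ω (us + t • (v - us)) x - νs x) =
      t * ∫ x in Ω, inner ℝ (ηs x) (weakGrad Ω v x - weakGrad Ω us x) := by
    rw [← integral_const_mul]
    refine integral_congr_ae ?_
    filter_upwards [hseg, hgrad] with x h1 h2
    rw [h1, ← h2]
    simp [inner_smul_right]
  have g3 : ∫ x in Ω, ‖weakGrad Ω (us + t • (v - us)) x - νs x‖ ^ 2 =
      t ^ 2 * ∫ x in Ω, ‖weakGrad Ω v x - weakGrad Ω us x‖ ^ 2 := by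
    rw [← integral_const_mul]
    refine integral_congr_ae ?_
    filter_upwards [hseg, hgrad] with x h1 h2
    rw [h1, ← h2]
    simp [norm_smul, mul_pow]
  have g4 : ∫ x in Ω, inner ℝ (ηs x) (weakGrad Ω us x - νs x) = 0 := by
    refine integral_eq_zero_of_ae ?_
    filter_upwards [hgrad] with x h2
    simp [h2]
  have g5 : ∫ x in Ω, ‖weakGrad Ω us x - νs x‖ ^ 2 = 0 := by
    refine integral_eq_zero_of_ae ?_
    filter_upwards [hgrad] with x h2
    simp [h2]
  rw [g1, g2, g3, g4, g5] at h
  linarith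

/-- This is `ηs ∈ ∂F(νs)`. Only `ν` varies, along a segment; convexity bounds the increment of `F`
by `t` times its total increment, so `F` need not be differentiated. -/
theorem variational_right (hs : IsSaddlePoint Ω p f r us νs ηs) (hp : AdmissibleExponent Ω p)
    {ν : Eu N → Eu N} (hν : MemVarLp Ω p ν) :
    ∫ x in Ω, inner ℝ (ηs x) (ν x - νs x) ≤ energyF Ω p ν - energyF Ω p νs := by
  have hgrad := hs.weakGrad_ae_eq hp
  have hD := hp.memVarLp_sub hν hs.mem_ν
  rw [← sub_nonneg]
  refine nonneg_of_forall_add_mul_sq (Y := volume.real Ω * (r / 2) * ∫ x in Ω, ‖ν x - νs x‖ ^ 2) fun t h0 h1 => ?_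
  have hseg := hp.memVarLp_add_smul hs.mem_ν hD t
  have h := hs.le_right us _ hs.mem_u hseg
  rw [hp.augLagrangian_eq hs.mem_u hs.mem_ν hs.mem_η,
    hp.augLagrangian_eq hs.mem_u hseg hs.mem_η] at h
  have g1 : energyF Ω p (νs + t • (ν - νs)) ≤
      energyF Ω p νs + t * (energyF Ω p ν - energyF Ω p νs) := by
    have i1 := hp.integrable_rpow_div hs.mem_ν
    have i2 := hp.integrable_rpow_div hν
    unfold energyF
    have i3 : Integrable (fun x => t * (‖ν x‖ ^ p x / p x - ‖νs x‖ ^ p x / p x))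
        (volume.restrict Ω) := (i2.sub i1).const_mul t
    rw [← integral_sub i2 i1, ← integral_const_mul, ← integral_add i1 i3]
    refine integral_mono_ae (hp.integrable_rpow_div hseg) (i1.add i3) ?_
    filter_upwards [hp.one_le] with x hx
    exact norm_rpow_div_convex hx _ _ h0.le h1
  have g2 : ∫ x in Ω, inner ℝ (ηs x) (weakGrad Ω us x - (νs + t • (ν - νs)) x) =
      -(t * ∫ x in Ω, inner ℝ (ηs x) (ν x - νs x)) := by
    rw [← integral_const_mul, ← integral_neg]
    refine integral_congr_ae ?_
    filter_upwards [hgrad] with x h2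
    rw [h2]
    simp [inner_smul_right, inner_neg_right]
  have g3 : ∫ x in Ω, ‖weakGrad Ω us x - (νs + t • (ν - νs)) x‖ ^ 2 =
      t ^ 2 * ∫ x in Ω, ‖ν x - νs x‖ ^ 2 := by
    rw [← integral_const_mul]
    refine integral_congr_ae ?_
    filter_upwards [hgrad] with x h2
    rw [h2]
    simp [norm_smul, mul_pow]
  have g4 : ∫ x in Ω, inner ℝ (ηs x) (weakGrad Ω us x - νs x) = 0 := by
    refine integral_eq_zero_of_ae ?_
    filter_upwards [hgrad] with x h2
    simp [h2]
  have g5 : ∫ x in Ω, ‖weakGrad Ω us x - νs x‖ ^ 2 = 0 := by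
    refine integral_eq_zero_of_ae ?_
    filter_upwards [hgrad] with x h2
    simp [h2]
  rw [g2, g3, g4, g5] at h
  linarith

end IsSaddlePoint

end VarExp

namespace VarExp

variable {N : ℕ} {Ω : Set (Eu N)} {p : Eu N → ℝ} {f : Eu N → ℝ} {r : ℝ}

/-! ### The modular controls the `L²` norm -/

/-- For `s ≤ δ` the first term suffices. For `s ≥ δ`, `s^q ≥ δ^{P-2} s²` because `δ ≤ 1`, and `P / q
≥ 1` absorbs the weight `2 / q`. The constants do not depend on `q`. -/
theorem sq_le_add_mul_rpow {q P δ s : ℝ} (hq : 2 ≤ q) (hqP : q ≤ P) (h0 : 0 < δ) (h1 : δ ≤ 1)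
    (hs : 0 ≤ s) : s ^ 2 ≤ δ ^ 2 + P / (2 * δ ^ (P - 2)) * (2 / q * s ^ q) := by
  have hδ : 0 < δ ^ (P - 2) := by positivity
  have hP : 0 < P := by linarith
  have hq0 : 0 < q := by linarith
  rcases le_total s δ with h | h
  · have : 0 ≤ P / (2 * δ ^ (P - 2)) * (2 / q * s ^ q) := by positivity
    nlinarith
  · have e : s ^ q = s ^ 2 * s ^ (q - 2) := by
      rw [← Real.rpow_two, ← Real.rpow_add' hs (by linarith)]; ring_nf
    have h2 : δ ^ (P - 2) ≤ s ^ (q - 2) :=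
      (Real.rpow_le_rpow_of_exponent_ge h0 h1 (by linarith)).trans
        (Real.rpow_le_rpow h0.le h (by linarith))
    have h3 : P / (2 * δ ^ (P - 2)) * (2 / q * s ^ q) =
        (P / q) * (s ^ (q - 2) / δ ^ (P - 2)) * s ^ 2 := by
      rw [e]; field_simp
    have h4 : 1 ≤ P / q := (one_le_div hq0).2 hqP
    have h5 : 1 ≤ s ^ (q - 2) / δ ^ (P - 2) := (one_le_div hδ).2 h2
    have h6 : 1 ≤ (P / q) * (s ^ (q - 2) / δ ^ (P - 2)) := one_le_mul_of_one_le_of_one_le h4 h5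
    rw [h3]
    nlinarith [sq_nonneg s, sq_nonneg δ]

theorem AdmissibleExponent.integrable_gain (hp : AdmissibleExponent Ω p) {w : Eu N → Eu N}
    (hw : MemVarLp Ω p w) :
    Integrable (fun x => 2 / p x * ‖(1 / 2 : ℝ) • w x‖ ^ p x) (volume.restrict Ω) := by
  refine ((hp.integrable_rpow_div (hw.smul hp.nonneg (1 / 2))).const_mul 2).congr
    (Eventually.of_forall fun x => ?_)
  simp only [Pi.smul_apply]
  ring

/-- Integrate `sq_le_add_mul_rpow` at `s = ‖w n x‖ / 2`, which explains the factor `1 / 4` below.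
First choose `δ` to make `|Ω| δ²` small, then `n` large for the modular term. -/
theorem AdmissibleExponent.tendsto_toL2_of_modular (hp : AdmissibleExponent Ω p)
    {w : ℕ → Eu N → Eu N} (hw : ∀ n, MemVarLp Ω p (w n))
    (h : Tendsto (fun n => ∫ x in Ω, 2 / p x * ‖(1 / 2 : ℝ) • w n x‖ ^ p x) atTop (𝓝 0)) :
    Tendsto (fun n => toL2 (volume.restrict Ω) (w n)) atTop (𝓝 0) := by
  have := isFiniteMeasure_restrict.2 hp.finite
  obtain ⟨P, hP⟩ := hp.bdd
  set M := fun n => ∫ x in Ω, 2 / p x * ‖(1 / 2 : ℝ) • w n x‖ ^ p x with hM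
  have key : ∀ δ : ℝ, 0 < δ → δ ≤ 1 → ∀ n, 1 / 4 * ‖toL2 (volume.restrict Ω) (w n)‖ ^ 2 ≤
      volume.real Ω * δ ^ 2 + P / (2 * δ ^ (P - 2)) * M n := by
    intro δ h0 h1 n
    have h2 := hp.memLp_two (hw n)
    have i1 := (hp.integrable_gain (hw n)).const_mul (P / (2 * δ ^ (P - 2)))
    have i2 : Integrable (fun x => ‖w n x‖ ^ 2) (volume.restrict Ω) := by
      simpa only [real_inner_self_eq_norm_sq] using integrable_inner_of_memLp_two h2 h2
    calc 1 / 4 * ‖toL2 (volume.restrict Ω) (w n)‖ ^ 2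
        = ∫ x in Ω, 1 / 4 * ‖w n x‖ ^ 2 := by rw [integral_const_mul, integral_norm_sq_eq h2]
      _ ≤ ∫ x in Ω, (δ ^ 2 + P / (2 * δ ^ (P - 2)) *
            (2 / p x * ‖(1 / 2 : ℝ) • w n x‖ ^ p x)) := by
          refine integral_mono_ae (i2.const_mul _) ((integrable_const _).add i1) ?_
          filter_upwards [hp.two_le, hP] with x hx hxP
          refine le_trans (le_of_eq ?_) (sq_le_add_mul_rpow hx hxP h0 h1 (norm_nonneg _))
          simp only [norm_smul, mul_pow]
          norm_num
      _ = _ := by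
          rw [integral_add (integrable_const _) i1, integral_const_mul, integral_const,
            measureReal_restrict_apply_univ, smul_eq_mul]
  have hsq : Tendsto (fun n => 1 / 4 * ‖toL2 (volume.restrict Ω) (w n)‖ ^ 2) atTop (𝓝 0) := by
    rw [tendsto_order]
    refine ⟨fun a ha => Eventually.of_forall fun n => ha.trans_le (by positivity), fun a ha => ?_⟩
    have hδ : Tendsto (fun δ : ℝ => volume.real Ω * δ ^ 2) (𝓝[>] 0) (𝓝 0) := by
      have : Tendsto (fun δ : ℝ => volume.real Ω * δ ^ 2) (𝓝 0) (𝓝 (volume.real Ω * 0 ^ 2)) := by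
        apply Continuous.tendsto; fun_prop
      simp only [ne_eq, OfNat.ofNat_ne_zero, not_false_eq_true, zero_pow, mul_zero] at this
      exact this.mono_left nhdsWithin_le_nhds
    obtain ⟨δ, hδa, hδ0, hδ1⟩ := ((hδ.eventually (gt_mem_nhds ha)).and
      (Ioo_mem_nhdsGT (zero_lt_one (α := ℝ)))).exists
    have hlim := (h.const_mul (P / (2 * δ ^ (P - 2)))).const_add (volume.real Ω * δ ^ 2)
    rw [mul_zero, add_zero] at hlim
    filter_upwards [hlim.eventually (gt_mem_nhds hδa)] with n hn
    exact (key δ hδ0 hδ1.le n).trans_lt hn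
  have h2 := (hsq.const_mul 4).sqrt
  refine tendsto_zero_iff_norm_tendsto_zero.2 ?_
  simpa [← mul_assoc, Real.sqrt_sq (norm_nonneg _)] using h2

/-! ### Error relations of the iteration -/

section Iteration

variable {us : Eu N → ℝ} {νs ηs : Eu N → Eu N} {u : ℕ → Eu N → ℝ} {ν η : ℕ → Eu N → Eu N}

theorem IsIteration.memVarLp_ν (hit : IsIteration Ω p f r u ν η) (n : ℕ) :
    MemVarLp Ω p (ν n) := by
  rcases Nat.eq_zero_or_pos n with rfl | hn
  · exact hit.init_ν
  · exact hit.mem_ν n hn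

theorem IsIteration.memVarLp_weakGrad_sub (hit : IsIteration Ω p f r u ν η)
    (hp : AdmissibleExponent Ω p) {n : ℕ} (hn : 1 ≤ n) :
    MemVarLp Ω p (weakGrad Ω (u n) - ν n) :=
  hp.memVarLp_sub (hit.mem_u n hn).1.2.2 (hit.mem_ν n hn)

/-- By (c) each update adds `r (∇(u n) - ν n)`, which lies in `L^p ⊆ L²`. -/
theorem IsIteration.memLp_multiplier_sub (hit : IsIteration Ω p f r u ν η)
    (hp : AdmissibleExponent Ω p) (hη : MemLp (η 1 - ηs) 2 (volume.restrict Ω)) {n : ℕ}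
    (hn : 1 ≤ n) : MemLp (η n - ηs) 2 (volume.restrict Ω) := by
  induction n, hn using Nat.le_induction with
  | base => exact hη
  | succ n hn ih =>
    refine (memLp_congr_ae ?_).1
      (ih.add ((hp.memLp_two (hit.memVarLp_weakGrad_sub hp hn)).const_smul r))
    filter_upwards [hit.step_c n hn] with x hx
    simp only [Pi.add_apply, Pi.sub_apply, Pi.smul_apply, hx]
    abel

/-- Split `η n = (η n - ηs) + ηs`: the first part pairs in `L²`, the second through the duality of
`L^{p'}` and `L^p`. -/
theorem IsIteration.integrable_inner_multiplier (hit : IsIteration Ω p f r u ν η)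
    (hp : AdmissibleExponent Ω p) (hs : IsSaddlePoint Ω p f r us νs ηs)
    (hη : MemLp (η 1 - ηs) 2 (volume.restrict Ω)) {n : ℕ} (hn : 1 ≤ n) {w : Eu N → Eu N}
    (hw : MemVarLp Ω p w) :
    Integrable (fun x => inner ℝ (η n x) (w x)) (volume.restrict Ω) := by
  refine ((integrable_inner_of_memLp_two (hit.memLp_multiplier_sub hp hη hn)
    (hp.memLp_two hw)).add (hp.integrable_inner hs.mem_η hw)).congr
      (Eventually.of_forall fun x => ?_)
  simp [inner_sub_left]

/-- Step (a) tested with `us`, combined with the equation for the saddle point. -/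
theorem IsIteration.error_a (hit : IsIteration Ω p f r u ν η)
    (hp : AdmissibleExponent Ω p) (hs : IsSaddlePoint Ω p f r us νs ηs)
    (hf : ∀ v : Eu N → ℝ, MemW10 Ω p v → IntegrableOn (fun x => f x * v x) Ω)
    (hη : MemLp (η 1 - ηs) 2 (volume.restrict Ω)) {n : ℕ} (hn : 1 ≤ n) :
    ∫ x in Ω, inner ℝ (((η n - ηs) + r • ((weakGrad Ω (u n) - weakGrad Ω us) -
      (ν (n - 1) - νs))) x) ((weakGrad Ω (u n) - weakGrad Ω us) x) ≤ 0 := by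
  have hU := hp.memVarLp_sub (hit.mem_u n hn).1.2.2 hs.mem_u.1.2.2
  have hV := hp.memVarLp_sub (hit.memVarLp_ν (n - 1)) hs.mem_ν
  have h1 := hit.step_a n hn us hs.mem_u
  have h2 := hs.variational_left hp hf (hit.mem_u n hn)
  have i1 := integrable_inner_of_memLp_two ((hit.memLp_multiplier_sub hp hη hn).add
    ((hp.memLp_two (hp.memVarLp_sub hU hV)).const_smul r)) (hp.memLp_two hU)
  have i2 := hp.integrable_inner hs.mem_η hU
  -- Each inequality is tested with the other's solution, so the terms in `f` cancel on addition.
  have e1 : ∫ x in Ω, f x * (u n x - us x) = -∫ x in Ω, f x * (us x - u n x) := by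
    rw [← integral_neg]
    exact integral_congr_ae (Eventually.of_forall fun x => by simp only; ring)
  have e2 : ∫ x in Ω, inner ℝ (η n x + r • (weakGrad Ω (u n) x - ν (n - 1) x))
      (weakGrad Ω us x - weakGrad Ω (u n) x) = -((∫ x in Ω, inner ℝ (((η n - ηs) +
        r • ((weakGrad Ω (u n) - weakGrad Ω us) - (ν (n - 1) - νs))) x)
          ((weakGrad Ω (u n) - weakGrad Ω us) x)) +
        ∫ x in Ω, inner ℝ (ηs x) ((weakGrad Ω (u n) - weakGrad Ω us) x)) := by
    rw [← integral_add i1 i2, ← integral_neg]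
    refine integral_congr_ae ?_
    filter_upwards [hs.weakGrad_ae_eq hp] with x hx
    simp only [Pi.add_apply, Pi.sub_apply, Pi.smul_apply]
    rw [← inner_add_left, ← inner_neg_right, neg_sub, hx]
    congr 1
    module
  rw [e1, e2] at h1
  simp only [Pi.add_apply, Pi.sub_apply, Pi.smul_apply] at h1 ⊢
  linarith

/-- Step (b) tested with `νs`, combined with the subgradient inequality for the saddle point. -/
theorem IsIteration.error_b (hit : IsIteration Ω p f r u ν η)
    (hp : AdmissibleExponent Ω p) (hs : IsSaddlePoint Ω p f r us νs ηs)
    (hη : MemLp (η 1 - ηs) 2 (volume.restrict Ω)) {n : ℕ} (hn : 1 ≤ n) :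
    (∫ x in Ω, 2 / p x * ‖(1 / 2 : ℝ) • (ν n - νs) x‖ ^ p x) +
      ∫ x in Ω, inner ℝ ((-(η n - ηs) + r • ((ν n - νs) -
        (weakGrad Ω (u n) - weakGrad Ω us))) x) ((ν n - νs) x) ≤ 0 := by
  have hU := hp.memVarLp_sub (hit.mem_u n hn).1.2.2 hs.mem_u.1.2.2
  have hV := hp.memVarLp_sub (hit.mem_ν n hn) hs.mem_ν
  have hV' := hp.memVarLp_sub hs.mem_ν (hit.mem_ν n hn)
  have h1 := hit.step_b n hn νs hs.mem_ν
  have h2 := hs.variational_right hp (hit.mem_ν n hn)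
  have i1 := hp.integrable_inner_rpow (hit.mem_ν n hn) hV'
  have i2 := integrable_inner_of_memLp_two ((hit.memLp_multiplier_sub hp hη hn).neg.add
    ((hp.memLp_two (hp.memVarLp_sub hV hU)).const_smul r)) (hp.memLp_two hV)
  have i3 := hp.integrable_inner hs.mem_η hV
  have i4 := hp.integrable_rpow_div hs.mem_ν
  have i5 := hp.integrable_rpow_div (hit.mem_ν n hn)
  have i6 := hp.integrable_gain hV
  have e1 : ∫ x in Ω, inner ℝ (‖ν n x‖ ^ (p x - 2) • ν n x - η n x +
      r • (ν n x - weakGrad Ω (u n) x)) (νs x - ν n x) =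
      (∫ x in Ω, inner ℝ (‖ν n x‖ ^ (p x - 2) • ν n x) ((νs - ν n) x)) -
        (∫ x in Ω, inner ℝ ((-(η n - ηs) + r • ((ν n - νs) -
          (weakGrad Ω (u n) - weakGrad Ω us))) x) ((ν n - νs) x)) +
        ∫ x in Ω, inner ℝ (ηs x) ((ν n - νs) x) := by
    refine Eq.trans ?_ ((integral_add (i1.sub i2) i3).trans (by rw [integral_sub' i1 i2]))
    refine integral_congr_ae ?_
    filter_upwards [hs.weakGrad_ae_eq hp] with x hx
    simp only [Pi.add_apply, Pi.sub_apply, Pi.smul_apply, Pi.neg_apply, hx]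
    rw [← neg_sub (ν n x) (νs x)]
    simp only [inner_add_left, inner_sub_left, inner_neg_right, inner_neg_left,
      real_inner_smul_left]
    ring
  -- Uniform convexity based at `ν n` produces the gain; the energy difference cancels against the
  -- subgradient inequality at `νs`.
  have e2 : ∫ x in Ω, inner ℝ (‖ν n x‖ ^ (p x - 2) • ν n x) ((νs - ν n) x) ≤
      energyF Ω p νs - energyF Ω p (ν n) -
        ∫ x in Ω, 2 / p x * ‖(1 / 2 : ℝ) • (ν n - νs) x‖ ^ p x := by
    refine le_trans ?_ ((integral_sub (i4.sub i5) i6).trans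
      (by rw [integral_sub' i4 i5, energyF, energyF])).le
    refine integral_mono_ae i1 ((i4.sub i5).sub i6) ?_
    filter_upwards [hp.two_le] with x hx
    have := norm_rpow_div_uniformConvex hx (ν n x) (νs x)
    simp only [Pi.sub_apply]
    linarith
  rw [e1] at h1
  simp only [Pi.add_apply, Pi.sub_apply, Pi.smul_apply, Pi.neg_apply] at h1 e2 ⊢
  linarith

/-- Step (b) at two consecutive indices, combined with the monotonicity of `ξ ↦ |ξ|^{p-2} ξ`. -/
theorem IsIteration.error_mono (hit : IsIteration Ω p f r u ν η)
    (hp : AdmissibleExponent Ω p) (hs : IsSaddlePoint Ω p f r us νs ηs) (hr : 0 < r)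
    (hη : MemLp (η 1 - ηs) 2 (volume.restrict Ω)) {n : ℕ} (hn : 1 ≤ n) :
    ∫ x in Ω, inner ℝ (((ν (n + 1) - νs) - (weakGrad Ω (u (n + 1)) - weakGrad Ω us)) x)
      (((ν (n + 1) - νs) - (ν n - νs)) x) ≤ 0 := by
  have hn' : 1 ≤ n + 1 := by omega
  have hD := hp.memVarLp_sub (hit.mem_ν n hn) (hit.mem_ν (n + 1) hn')
  have hD' := hp.memVarLp_sub (hit.mem_ν (n + 1) hn') (hit.mem_ν n hn)
  have h1 := hit.step_b (n + 1) hn' (ν n) (hit.mem_ν n hn)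
  have h2 := hit.step_b n hn (ν (n + 1)) (hit.mem_ν (n + 1) hn')
  have hW := hp.memVarLp_sub (hp.memVarLp_sub (hit.mem_ν (n + 1) hn') hs.mem_ν)
    (hp.memVarLp_sub (hit.mem_u (n + 1) hn').1.2.2 hs.mem_u.1.2.2)
  have hR : MemLp (r • (ν (n + 1) - weakGrad Ω (u (n + 1)))) 2 (volume.restrict Ω) :=
    (hp.memLp_two (hp.memVarLp_sub (hit.mem_ν (n + 1) hn')
      (hit.mem_u (n + 1) hn').1.2.2)).const_smul r
  have i1 : Integrable (fun x => inner ℝ (‖ν (n + 1) x‖ ^ (p x - 2) • ν (n + 1) x - η (n + 1) x +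
      r • (ν (n + 1) x - weakGrad Ω (u (n + 1)) x)) (ν n x - ν (n + 1) x))
      (volume.restrict Ω) := by
    refine (((hp.integrable_inner_rpow (hit.mem_ν (n + 1) hn') hD).sub
      (hit.integrable_inner_multiplier hp hs hη hn' hD)).add
      (integrable_inner_of_memLp_two hR (hp.memLp_two hD))).congr
        (Eventually.of_forall fun x => ?_)
    simp only [Pi.add_apply, Pi.sub_apply, Pi.smul_apply, inner_add_left, inner_sub_left]
  -- By (c), `-η n + r (ν n - ∇(u n)) = -η (n + 1)`, so the two steps (b) carry the same multiplier,
  -- which drops out of their sum.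
  have e2 : ∀ᵐ x ∂(volume.restrict Ω), inner ℝ (‖ν n x‖ ^ (p x - 2) • ν n x) ((ν (n + 1) - ν n) x)
      - inner ℝ (η (n + 1) x) ((ν (n + 1) - ν n) x) =
      inner ℝ (‖ν n x‖ ^ (p x - 2) • ν n x - η n x +
        r • (ν n x - weakGrad Ω (u n) x)) (ν (n + 1) x - ν n x) := by
    filter_upwards [hit.step_c n hn] with x hx
    rw [← inner_sub_left, hx]
    simp only [Pi.sub_apply]
    congr 1
    module
  have i2 := ((hp.integrable_inner_rpow (hit.mem_ν n hn) hD').sub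
    (hit.integrable_inner_multiplier hp hs hη hn' hD')).congr e2
  have i3 := (integrable_inner_of_memLp_two (hp.memLp_two hW) (hp.memLp_two hD')).const_mul r
  have key : 0 ≤ -(r * ∫ x in Ω, inner ℝ (((ν (n + 1) - νs) -
      (weakGrad Ω (u (n + 1)) - weakGrad Ω us)) x) ((ν (n + 1) - ν n) x)) := by
    refine (add_nonneg h1 h2).trans ?_
    rw [← integral_add i1 i2, ← integral_const_mul, ← integral_neg]
    refine integral_mono_ae (i1.add i2) i3.neg ?_
    filter_upwards [hp.two_le, e2, hs.weakGrad_ae_eq hp] with x hx h3 h4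
    have h5 := inner_rpow_smul_monotone hx (ν (n + 1) x) (ν n x)
    have e3 : inner ℝ (‖ν (n + 1) x‖ ^ (p x - 2) • ν (n + 1) x - η (n + 1) x +
        r • (ν (n + 1) x - weakGrad Ω (u (n + 1)) x)) (ν n x - ν (n + 1) x) =
        -(inner ℝ (‖ν (n + 1) x‖ ^ (p x - 2) • ν (n + 1) x) (ν (n + 1) x - ν n x)
          - inner ℝ (η (n + 1) x) (ν (n + 1) x - ν n x)
          + r * inner ℝ (ν (n + 1) x - weakGrad Ω (u (n + 1)) x) (ν (n + 1) x - ν n x)) := by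
      rw [← neg_sub (ν (n + 1) x) (ν n x), inner_neg_right, inner_add_left, inner_sub_left,
        real_inner_smul_left _ _ r]
    have e4 : ν (n + 1) x - νs x - (weakGrad Ω (u (n + 1)) x - νs x) =
      ν (n + 1) x - weakGrad Ω (u (n + 1)) x := by abel
    simp only [Pi.sub_apply] at h3 ⊢
    rw [← h3, e3, h4, e4]
    rw [inner_sub_left] at h5
    linarith
  have h6 := nonpos_of_mul_nonpos_right (neg_nonneg.1 key) hr
  rwa [sub_sub_sub_cancel_right]

theorem IsIteration.errorRelations (hit : IsIteration Ω p f r u ν η)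
    (hp : AdmissibleExponent Ω p) (hs : IsSaddlePoint Ω p f r us νs ηs) (hr : 0 < r)
    (hf : ∀ v : Eu N → ℝ, MemW10 Ω p v → IntegrableOn (fun x => f x * v x) Ω)
    (hη : MemLp (η 1 - ηs) 2 (volume.restrict Ω)) :
    ErrorRelations r (fun n => toL2 (volume.restrict Ω) (η n - ηs))
      (fun n => toL2 (volume.restrict Ω) (weakGrad Ω (u n) - weakGrad Ω us))
      (fun n => toL2 (volume.restrict Ω) (ν n - νs))
      (fun n => ∫ x in Ω, 2 / p x * ‖(1 / 2 : ℝ) • (ν n - νs) x‖ ^ p x) := by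
  have hU : ∀ n, 1 ≤ n → MemLp (weakGrad Ω (u n) - weakGrad Ω us) 2 (volume.restrict Ω) :=
    fun n hn => hp.memLp_two (hp.memVarLp_sub (hit.mem_u n hn).1.2.2 hs.mem_u.1.2.2)
  have hV : ∀ n, MemLp (ν n - νs) 2 (volume.restrict Ω) :=
    fun n => hp.memLp_two (hp.memVarLp_sub (hit.memVarLp_ν n) hs.mem_ν)
  have hE : ∀ n, 1 ≤ n → MemLp (η n - ηs) 2 (volume.restrict Ω) :=
    fun n hn => hit.memLp_multiplier_sub hp hη hn
  refine ⟨fun n hn => ?_, fun n hn => ?_, fun n hn => ?_, fun n hn => ?_, fun n => ?_⟩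
  · have h := (hU n hn).sub (hV (n - 1))
    rw [← toL2_sub (hU n hn) (hV (n - 1)), ← toL2_smul h, ← toL2_add (hE n hn) (h.const_smul r),
      inner_toL2 ((hE n hn).add (h.const_smul r)) (hU n hn)]
    exact hit.error_a hp hs hf hη hn
  · have h := (hV n).sub (hU n hn)
    rw [← toL2_sub (hV n) (hU n hn), ← toL2_smul h, ← toL2_neg (hE n hn),
      ← toL2_add (hE n hn).neg (h.const_smul r),
      inner_toL2 ((hE n hn).neg.add (h.const_smul r)) (hV n)]
    exact hit.error_b hp hs hη hn
  · have h := (hU n hn).sub (hV n)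
    rw [← toL2_sub (hU n hn) (hV n), ← toL2_smul h, ← toL2_add (hE n hn) (h.const_smul r)]
    refine toL2_congr (hE (n + 1) (by omega)) ?_
    filter_upwards [hit.step_c n hn, hs.weakGrad_ae_eq hp] with x h1 h2
    simp only [Pi.add_apply, Pi.sub_apply, Pi.smul_apply, h1, h2]
    module
  · have hn' : 1 ≤ n + 1 := by omega
    rw [← toL2_sub (hV _) (hU _ hn'), ← toL2_sub (hV _) (hV _),
      inner_toL2 ((hV _).sub (hU _ hn')) ((hV _).sub (hV _))]
    exact hit.error_mono hp hs hr hη hn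
  · refine integral_nonneg_of_ae ?_
    filter_upwards [hp.nonneg] with x hx
    simp only [Pi.zero_apply]
    positivity

end Iteration

/-! ### Passage to convergence in norm -/

theorem tendsto_eLpNorm_of_tendsto_toL2 {α E : Type*} [MeasurableSpace α] [NormedAddCommGroup E]
    {μ : Measure α} {w : ℕ → α → E} (hw : ∀ n, 1 ≤ n → MemLp (w n) 2 μ)
    (h : Tendsto (fun n => toL2 μ (w n)) atTop (𝓝 0)) :
    Tendsto (fun n => eLpNorm (w n) 2 μ) atTop (𝓝 0) := by
  have h1 := h.enorm
  rw [enorm_zero] at h1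
  refine h1.congr' ?_
  -- At index 0 the field may fail to be square integrable, and `toL2` is then the default 0; the
  -- limit ignores this index.
  filter_upwards [eventually_ge_atTop 1] with n hn
  exact enorm_toL2 (hw n hn)

/-- In `H_0^1(Ω)`, convergence of gradients in `L²` implies convergence in norm. -/
theorem tendsto_h1Norm (hN : 1 ≤ N) (hΩ : IsOpen Ω) (hΩb : Bornology.IsBounded Ω)
    {w : ℕ → Eu N → ℝ} (hw : ∀ n, 1 ≤ n → MemH10 Ω (w n))
    (h : Tendsto (fun n => eLpNorm (weakGrad Ω (w n)) 2 (volume.restrict Ω)) atTop (𝓝 0)) :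
    Tendsto (fun n => h1Norm Ω (w n)) atTop (𝓝 0) := by
  obtain ⟨R, hR0, hR⟩ := hΩb.exists_pos_norm_le
  lift R to ℝ≥0 using hR0.le
  have hu : Tendsto (fun n => eLpNorm (w n) 2 (volume.restrict Ω)) atTop (𝓝 0) := by
    have hlim := ENNReal.Tendsto.const_mul (a := 2 * (R : ℝ≥0∞)) h (Or.inr (by finiteness))
    rw [mul_zero] at hlim
    refine tendsto_of_tendsto_of_tendsto_of_le_of_le' tendsto_const_nhds hlim
      (Eventually.of_forall fun _ => zero_le) ?_
    filter_upwards [eventually_ge_atTop 1] with n hn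
    exact (hw n hn).eLpNorm_le hN hΩ hR
  have hsum := (((ENNReal.continuous_pow 2).tendsto _).comp hu).add
    (((ENNReal.continuous_pow 2).tendsto _).comp h)
  have := (ENNReal.continuous_rpow_const (y := 1 / 2)).tendsto _ |>.comp hsum
  simpa [Function.comp_def, h1Norm] using this

end VarExp

/-! ### Convergence of the decomposition–coordination algorithm -/

theorem mainTheorem1 {N : ℕ} (hN : 1 ≤ N)
    (Ω : Set (VarExp.Eu N)) (hΩ : IsOpen Ω) (hΩb : Bornology.IsBounded Ω)
    (p : VarExp.Eu N → ℝ) (hpm : AEMeasurable p (volume.restrict Ω))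
    (hp2 : ∀ᵐ x ∂(volume.restrict Ω), 2 ≤ p x)
    (hpb : ∃ P : ℝ, ∀ᵐ x ∂(volume.restrict Ω), p x ≤ P)
    (f : VarExp.Eu N → ℝ)
    (hf : ∀ v : VarExp.Eu N → ℝ, VarExp.MemW10 Ω p v → IntegrableOn (fun x => f x * v x) Ω)
    (r : ℝ) (hr : 0 < r)
    (us : VarExp.Eu N → ℝ) (νs ηs : VarExp.Eu N → VarExp.Eu N)
    (hs : VarExp.IsSaddlePoint Ω p f r us νs ηs)
    (u : ℕ → VarExp.Eu N → ℝ) (ν η : ℕ → VarExp.Eu N → VarExp.Eu N)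
    (hit : VarExp.IsIteration Ω p f r u ν η)
    (hη : MemLp (η 1 - ηs) 2 (volume.restrict Ω)) :
    ((∀ n, 1 ≤ n → VarExp.MemH10 Ω (u n)) ∧ VarExp.MemH10 Ω us ∧
      Tendsto (fun n => VarExp.h1Norm Ω (u n - us)) atTop (𝓝 0)) ∧
    ((∀ n, MemLp (ν n) 2 (volume.restrict Ω)) ∧ MemLp νs 2 (volume.restrict Ω) ∧
      Tendsto (fun n => eLpNorm (ν n - νs) 2 (volume.restrict Ω)) atTop (𝓝 0)) ∧
    ((∀ n, 1 ≤ n → MemLp (η (n + 1) - η n) 2 (volume.restrict Ω)) ∧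
      Tendsto (fun n => eLpNorm (η (n + 1) - η n) 2 (volume.restrict Ω)) atTop (𝓝 0)) ∧
    ((∃ C : ℝ≥0, ∀ n, 1 ≤ n → MemLp (η n - ηs) 2 (volume.restrict Ω) ∧
        eLpNorm (η n - ηs) 2 (volume.restrict Ω) ≤ C) ∧
      (MemLp (η 1) 2 (volume.restrict Ω) → ∃ C : ℝ≥0, ∀ n, 1 ≤ n →
        MemLp (η n) 2 (volume.restrict Ω) ∧ eLpNorm (η n) 2 (volume.restrict Ω) ≤ C)) := by
  have hp : VarExp.AdmissibleExponent Ω p := ⟨hΩ, hΩb.measure_lt_top.ne, hpm, hp2, hpb⟩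
  have hcast : ∀ v, VarExp.MemW10 Ω p v → VarExp.MemH10 Ω v := fun v hv =>
    hv.mono_exponent hp.finite (by simp) hp2
  have hU : ∀ n, 1 ≤ n →
      MemLp (VarExp.weakGrad Ω (u n) - VarExp.weakGrad Ω us) 2 (volume.restrict Ω) :=
    fun n hn => hp.memLp_two (hp.memVarLp_sub (hit.mem_u n hn).1.2.2 hs.mem_u.1.2.2)
  have hVp : ∀ n, VarExp.MemVarLp Ω p (ν n - νs) := fun n =>
    hp.memVarLp_sub (hit.memVarLp_ν n) hs.mem_ν
  have hV : ∀ n, MemLp (ν n - νs) 2 (volume.restrict Ω) := fun n => hp.memLp_two (hVp n)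
  have hE : ∀ n, 1 ≤ n → MemLp (η n - ηs) 2 (volume.restrict Ω) :=
    fun n hn => hit.memLp_multiplier_sub hp hη hn
  obtain ⟨hUV, hM, C, hC⟩ := (hit.errorRelations hp hs hr hf hη).tendsto hr
  have hV0 := hp.tendsto_toL2_of_modular hVp hM
  have hU0 : Tendsto (fun n => VarExp.toL2 (volume.restrict Ω)
      (VarExp.weakGrad Ω (u n) - VarExp.weakGrad Ω us)) atTop (𝓝 0) := by
    simpa using hUV.add hV0
  have hstep : ∀ n, 1 ≤ n → η (n + 1) - η n =ᵐ[volume.restrict Ω]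
      -- The saddle-point fields cancel because `∇us = νs`, so the increment is `r (U n - V n)`.
      r • ((VarExp.weakGrad Ω (u n) - VarExp.weakGrad Ω us) - (ν n - νs)) := fun n hn => by
    filter_upwards [hit.step_c n hn, hs.weakGrad_ae_eq hp] with x h1 h2
    simp only [Pi.sub_apply, Pi.smul_apply, h1, h2]
    module
  have hdiff : ∀ n, 1 ≤ n → MemLp (η (n + 1) - η n) 2 (volume.restrict Ω) := fun n hn =>
    (memLp_congr_ae (hstep n hn)).2 (((hU n hn).sub (hV n)).const_smul r)
  have hbdd : ∀ n, 1 ≤ n → eLpNorm (η n - ηs) 2 (volume.restrict Ω) ≤ C.toNNReal :=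
    fun n hn => by
      rw [← VarExp.enorm_toL2 (hE n hn), ← ofReal_norm]
      exact ENNReal.ofReal_le_ofReal (hC n)
  refine ⟨⟨fun n hn => hcast _ (hit.mem_u n hn), hcast _ hs.mem_u, ?_⟩,
    ⟨fun n => hp.memLp_two (hit.memVarLp_ν n), hp.memLp_two hs.mem_ν,
      VarExp.tendsto_eLpNorm_of_tendsto_toL2 (fun n _ => hV n) hV0⟩,
    ⟨hdiff, VarExp.tendsto_eLpNorm_of_tendsto_toL2 hdiff ?_⟩,
    ⟨C.toNNReal, fun n hn => ⟨hE n hn, hbdd n hn⟩⟩, fun hη1 => ?_⟩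
  · refine VarExp.tendsto_h1Norm hN hΩ hΩb
      (fun n hn => hcast _ (hp.memW10_sub hs.mem_u (hit.mem_u n hn))) ?_
    refine (VarExp.tendsto_eLpNorm_of_tendsto_toL2 hU hU0).congr' ?_
    filter_upwards [eventually_ge_atTop 1] with n hn
    exact eLpNorm_congr_ae (hp.weakGrad_sub hs.mem_u (hit.mem_u n hn)).symm
  · have hlim := hUV.const_smul r
    rw [smul_zero] at hlim
    refine hlim.congr' ?_
    filter_upwards [eventually_ge_atTop 1] with n hn
    rw [VarExp.toL2_congr (hdiff n hn) (hstep n hn),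
      VarExp.toL2_smul ((hU n hn).sub (hV n)), VarExp.toL2_sub (hU n hn) (hV n)]
  -- Square integrability of `η 1` passes to `ηs = η 1 - (η 1 - ηs)`, and the bound on the errors
  -- then bounds the multipliers.
  · have hηs : MemLp ηs 2 (volume.restrict Ω) := by simpa using hη1.sub hη
    refine ⟨C.toNNReal + (eLpNorm ηs 2 (volume.restrict Ω)).toNNReal, fun n hn => ?_⟩
    have h1 : MemLp (η n) 2 (volume.restrict Ω) := by simpa using (hE n hn).add hηs
    refine ⟨h1, ?_⟩
    have h2 := eLpNorm_add_le (p := 2) (hE n hn).1 hηs.1 (by norm_num)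
    rw [sub_add_cancel] at h2
    rw [ENNReal.coe_add, ENNReal.coe_toNNReal hηs.2.ne]
    exact h2.trans (by gcongr; exact hbdd n hn)
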